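/- Let $D$ be the space of real c\`adl\`ag functions on $[0,1]$, with sup norm $\|\cdot\|$. Let $\Lambda$ be the set of strictly increasing continuous maps of $[0,1]$ onto itself, $e$ the identity, and $\|\lambda\|^0=\sup_{s<s'}\bigl|\log\frac{\lambda(s')-\lambda(s)}{s'-s}\bigr|$ for $\lambda\in\Lambda$. Equip $D$ with the distance $$d^0(y,z)=\inf_{\lambda\in\Lambda}\{\|\lambda\|^0\vee\|y-z\circ\lambda\|\},$$ which induces the $J_1$ topology. Let $D([0,1];D)$ be the space of functions $x:[0,1]\to D$ that are right-continuous on $[0,1)$ and have left limits on $(0,1]$ with respect to $J_1$, equipped with the distance $$d_D(x,y)=\inf_{\lambda\in\Lambda}\Bigl\{\sup_{t}|\lambda(t)-t|\vee\sup_{t\in[0,1]}d^0\bigl(x(t),y(\lambda(t))\bigr)\Bigr\}$$ and its Borel $\sigma$-field; write $x(t,s)=x(t)(s)$, and $x(t,1-)$ for the left limit of $s\mapsto x(t,s)$ at $s=1$. Finite powers $D^k$ carry the product topology. Put $$w''(y,\delta)=\sup_{s_1\le s\le s_2,\ s_2-s_1\le\delta}\bigl(|y(s)-y(s_1)|\wedge|y(s_2)-y(s)|\bigr)\quad(y\in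 D),$$ $$w_D''(x,\delta)=\sup_{t_1\le t\le t_2,\ t_2-t_1\le\delta}\bigl(d^0(x(t),x(t_1))\wedge d^0(x(t_2),x(t))\bigr)\quad(x\in D([0,1];D)).$$ **(1) Probability measures.** Let $(P_n)_{n\ge1}$ and $P$ be Borel probability measures on $D([0,1];D)$, let $\pi_{t_1,\dots,t_k}(x)=(x(t_1),\dots,x(t_k))$, and let $T_P$ be the set of $t\in[0,1]$ such that $\pi_t$ is $d_D$-continuous at $P$-almost every $x$. Assume that: - $P_n\circ\pi_{t_1,\dots,t_k}^{-1}$ converges weakly to $P\circ\pi_{t_1,\dots,t_k}^{-1}$ in $D^k$ for all $k\ge1$ and all $t_1,\dots,t_k\in T_P$; - for every $\varepsilon>0$, $$\lim_{\delta\to0}\limsup_{n\to\infty}P_n\{x: w''(x(t),\delta)\ge\varepsilon\text{ for some }t\in[0,1]\}=0,$$ $$\lim_{\delta\to0}\limsup_{n\to\infty}P_n\{x: |x(t,\delta)-x(t,0)|\ge\varepsilon\text{ for some }t\in[0,1]\}=0,$$ $$\lim_{\delta\to0}\limsup_{n\to\infty}P_n\{x: |x(t,1-)-x(t,1-\delta)|\ge\varepsilon\text{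 for some }t\in[0,1]\}=0;$$ - for every $\varepsilon>0$, $\lim_{\delta\to0}\limsup_{n\to\infty}P_n\{x: w_D''(x,\delta)\ge\varepsilon\}=0$; - for every $\varepsilon>0$, $\lim_{\delta\to0}P\{x: d^0(x(1),x(1-\delta))\ge\varepsilon\}=0$. Then $P_n$ converges weakly to $P$ on $(D([0,1];D),d_D)$. **(2) Random elements.** Let $(X_n)_{n\ge1}$ and $X$ be random elements in $D([0,1];D)$ (Borel measurable maps) defined on one probability space $(\Omega,\mathcal F,\mathbb P)$, and let $T_X=\{t\in[0,1]:\mathbb P(X(t)=X(t-))=1\}$, with the convention $X(0-)=X(0)$. Assume that: - a) $(X_n(t_1),\dots,X_n(t_k))\to(X(t_1),\dots,X(t_k))$ in distribution in $D^k$ for all $k\ge1$ and all $t_1,\dots,t_k\in T_X$; - b) $d^0(X(1),X(1-\delta))\to0$ in $\mathbb P$-probability as $\delta\to0$; - c) for every $\varepsilon>0$, $\lim_{\delta\to0}\limsup_{n\to\infty}$ of each of the probabilities $\mathbb P(w''(X_n(t),\delta)\ge\varepsilon\text{ for some }t\in[0,1])$, $\mathbb P(|X_n(t,\delta)-X_n(t,0)|\ge\varepsilon\text{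 for some }t\in[0,1])$ and $\mathbb P(|X_n(t,1-)-X_n(t,1-\delta)|\ge\varepsilon\text{ for some }t\in[0,1])$ is $0$; - d) for every $\varepsilon>0$, $\lim_{\delta\to0}\limsup_{n\to\infty}\mathbb P(w_D''(X_n,\delta)\ge\varepsilon)=0$. Then $X_n\to X$ in distribution in $(D([0,1];D),d_D)$. -/

import Mathlib

open Filter Topology MeasureTheory Set
open scoped ENNReal BoundedContinuousFunction unitInterval

noncomputable section

/-- The space `D([0,1]; S)` of functions on `[0,1]` with values in `S` that are right-continuous
and have left limits (both conditions are void at `1`, respectively at `0`). -/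
structure Cadlag (S : Type*) [TopologicalSpace S] where
  toFun : I → S
  rightCts' : ∀ t : I, ContinuousWithinAt toFun (Ici t) t
  leftLim' : ∀ t : I, ∃ l : S, Tendsto toFun (𝓝[<] t) (𝓝 l)

instance {S : Type*} [TopologicalSpace S] : CoeFun (Cadlag S) (fun _ => I → S) := ⟨Cadlag.toFun⟩

/-- The set `Λ` of strictly increasing continuous maps of `[0,1]` onto itself; these are exactly
the order automorphisms of `[0,1]`. -/
abbrev TimeChange : Type := I ≃o I

namespace TimeChange

/-- `‖l - e‖ = sup_s |l(s) - s|`. -/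
def distId (l : TimeChange) : ℝ≥0∞ := ⨆ s : I, ENNReal.ofReal |(l s : ℝ) - s|

/-- `‖l‖⁰ = sup_{s < s'} |log ((l(s') - l(s)) / (s' - s))|`, possibly infinite. -/
def logSlope (l : TimeChange) : ℝ≥0∞ :=
  ⨆ (s : I) (s' : I) (_ : s < s'), ENNReal.ofReal |Real.log (((l s' : ℝ) - l s) / ((s' : ℝ) - s))|

lemma distId_refl : distId (OrderIso.refl I) = 0 := by
  simp [distId]

lemma distId_symm_le (l : TimeChange) : distId l.symm ≤ distId l := by
  refine iSup_le fun s => ?_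
  refine le_trans (le_of_eq ?_) (le_iSup (fun s : I => ENNReal.ofReal |(l s : ℝ) - s|) (l.symm s))
  simp [abs_sub_comm]

lemma distId_trans_le (l m : TimeChange) : distId (l.trans m) ≤ distId l + distId m := by
  refine iSup_le fun s => ?_
  have h1 := le_iSup (fun s : I => ENNReal.ofReal |(l s : ℝ) - s|) s
  have h2 := le_iSup (fun s : I => ENNReal.ofReal |(m s : ℝ) - s|) (l s)
  refine le_trans ?_ (add_le_add h1 h2)
  rw [← ENNReal.ofReal_add (abs_nonneg _) (abs_nonneg _)]
  refine ENNReal.ofReal_le_ofReal ?_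
  have := abs_sub_le (m (l s) : ℝ) (l s) s
  simp only [OrderIso.trans_apply]
  linarith

lemma logSlope_refl : logSlope (OrderIso.refl I) = 0 := by
  simp only [logSlope, ENNReal.iSup_eq_zero]
  intro s s' h
  have : (s' : ℝ) - s ≠ 0 := sub_ne_zero.2 (ne_of_gt (by exact_mod_cast h))
  simp [div_self this]

lemma le_logSlope (l : TimeChange) {s s' : I} (h : s < s') :
    ENNReal.ofReal |Real.log (((l s' : ℝ) - l s) / ((s' : ℝ) - s))| ≤ logSlope l :=
  le_iSup_of_le s (le_iSup_of_le s' (le_iSup_of_le h le_rfl))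

lemma logSlope_symm_le (l : TimeChange) : logSlope l.symm ≤ logSlope l := by
  refine iSup_le fun s => iSup_le fun s' => iSup_le fun h => ?_
  refine le_trans (le_of_eq ?_) (le_logSlope l (l.symm.strictMono h))
  rw [OrderIso.apply_symm_apply, OrderIso.apply_symm_apply, ← abs_neg, ← Real.log_inv, inv_div]

lemma logSlope_trans_le (l m : TimeChange) : logSlope (l.trans m) ≤ logSlope l + logSlope m := by
  refine iSup_le fun s => iSup_le fun s' => iSup_le fun h => ?_
  have hl : l s < l s' := l.strictMono h
  have hm : m (l s) < m (l s') := m.strictMono hl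
  refine le_trans ?_ (add_le_add (le_logSlope l h) (le_logSlope m hl))
  rw [← ENNReal.ofReal_add (abs_nonneg _) (abs_nonneg _)]
  refine ENNReal.ofReal_le_ofReal ?_
  have p0 : (0 : ℝ) < (s' : ℝ) - s := sub_pos.2 (by exact_mod_cast h)
  have p1 : (0 : ℝ) < (l s' : ℝ) - l s := sub_pos.2 (by exact_mod_cast hl)
  have p2 : (0 : ℝ) < (m (l s') : ℝ) - m (l s) := sub_pos.2 (by exact_mod_cast hm)
  simp only [OrderIso.trans_apply]
  have e : ((m (l s') : ℝ) - m (l s)) / ((s' : ℝ) - s) =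
      (((l s' : ℝ) - l s) / ((s' : ℝ) - s)) * (((m (l s') : ℝ) - m (l s)) / ((l s' : ℝ) - l s)) := by
    field_simp
  rw [e, Real.log_mul (by positivity) (by positivity)]
  exact abs_add_le _ _

end TimeChange

section Dist

variable {S : Type*} [PseudoEMetricSpace S]

/-- `inf_{l ∈ Λ} max (N l) (sup_t dist (x(t), y(l(t))))`, where `N` measures how far `l` is from
the identity. -/
def timeChangeDist (N : TimeChange → ℝ≥0∞) (x y : I → S) : ℝ≥0∞ :=
  ⨅ l : TimeChange, max (N l) (⨆ t : I, edist (x t) (y (l t)))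

/-- `timeChangeDist` is a pseudometric if `N` is a length function on the group `Λ`. Both distances
below are in fact finite and separate points; the topology only needs the axioms proved here. -/
@[reducible]
def timeChangePseudoEMetric (N : TimeChange → ℝ≥0∞) (h1 : N (OrderIso.refl I) = 0)
    (h2 : ∀ l : TimeChange, N l.symm ≤ N l)
    (h3 : ∀ l m : TimeChange, N (l.trans m) ≤ N l + N m) : PseudoEMetricSpace (Cadlag S) where
  edist x y := timeChangeDist N x y
  edist_self x := by
    refine le_antisymm (iInf_le_of_le (OrderIso.refl I) ?_) bot_le
    simp [h1]
  edist_comm := by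
    have key : ∀ x y : I → S, timeChangeDist N x y ≤ timeChangeDist N y x := by
      intro x y
      refine le_iInf fun l => iInf_le_of_le l.symm (max_le_max (h2 l) (iSup_le fun t => ?_))
      refine le_trans (le_of_eq ?_) (le_iSup (fun t : I => edist (y t) (x (l t))) (l.symm t))
      rw [OrderIso.apply_symm_apply, edist_comm]
    exact fun x y => le_antisymm (key _ _) (key _ _)
  edist_triangle x y z := by
    simp only [timeChangeDist]
    rw [ENNReal.iInf_add]
    refine le_iInf fun l => ?_
    rw [ENNReal.add_iInf]
    refine le_iInf fun m => ?_
    refine iInf_le_of_le (l.trans m) (max_le ?_ (iSup_le fun t => ?_))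
    · exact (h3 l m).trans (add_le_add (le_max_left _ _) (le_max_left _ _))
    · refine (edist_triangle (x t) (y (l t)) (z (m (l t)))).trans (add_le_add ?_ ?_)
      · exact le_trans (le_iSup (fun t : I => edist (x t) (y (l t))) t) (le_max_right _ _)
      · exact le_trans (le_iSup (fun t : I => edist (y t) (z (m t))) (l t)) (le_max_right _ _)

/-- The modulus
`w''(x, δ) = sup {min (dist (x(t), x(t₁))) (dist (x(t₂), x(t))) | t₁ ≤ t ≤ t₂, t₂ - t₁ ≤ δ}`. -/
def modulusTwo (x : I → S) (δ : ℝ) : ℝ≥0∞ :=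
  ⨆ (t₁ : I) (t : I) (t₂ : I) (_ : t₁ ≤ t ∧ t ≤ t₂ ∧ (t₂ : ℝ) - t₁ ≤ δ),
    min (edist (x t) (x t₁)) (edist (x t₂) (x t))

end Dist

/-- The Skorohod space `D` of real càdlàg functions on `[0,1]`. -/
abbrev SkorohodD : Type := Cadlag ℝ

/-- `D` carries the complete Skorohod distance
`d⁰(x, y) = inf_l max ‖l‖⁰ ‖x - y ∘ l‖`, which induces the `J₁` topology. -/
instance : PseudoEMetricSpace SkorohodD :=
  timeChangePseudoEMetric TimeChange.logSlope TimeChange.logSlope_refl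
    TimeChange.logSlope_symm_le TimeChange.logSlope_trans_le

instance : MeasurableSpace SkorohodD := borel SkorohodD
instance : BorelSpace SkorohodD := ⟨rfl⟩

/-- The space `D([0,1]; D)` of functions that are càdlàg for the `J₁` topology on `D`. -/
abbrev SkorohodDD : Type := Cadlag SkorohodD

/-- `D([0,1]; D)` carries the Skorohod distance
`d(x, y) = inf_l max ‖l - e‖ (sup_t d⁰(x(t), y(l(t))))`. -/
instance : PseudoEMetricSpace SkorohodDD :=
  timeChangePseudoEMetric TimeChange.distId TimeChange.distId_refl
    TimeChange.distId_symm_le TimeChange.distId_trans_le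

instance : MeasurableSpace SkorohodDD := borel SkorohodDD
instance : BorelSpace SkorohodDD := ⟨rfl⟩

/-- The projection `x ↦ (x(t₁), …, x(t_k))` from `D([0,1]; D)` to `D^k`. -/
def finProj {k : ℕ} (t : Fin k → I) (x : SkorohodDD) : Fin k → SkorohodD := fun i => x (t i)

/-- `μ n` converges weakly to `ν`: integrals of bounded continuous real functions converge. -/
def ConvergesWeakly {S : Type*} [TopologicalSpace S] [MeasurableSpace S]
    (μ : ℕ → Measure S) (ν : Measure S) : Prop :=
  ∀ f : S →ᵇ ℝ, Tendsto (fun n => ∫ s, f s ∂(μ n)) atTop (𝓝 (∫ s, f s ∂ν))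

/-- For probability measures this is convergence in Mathlib's topology of weak convergence. -/
lemma convergesWeakly_iff {S : Type*} [TopologicalSpace S] [MeasurableSpace S]
    [OpensMeasurableSpace S] (μ : ℕ → ProbabilityMeasure S) (ν : ProbabilityMeasure S) :
    ConvergesWeakly (fun n => (μ n : Measure S)) ν ↔ Tendsto μ atTop (𝓝 ν) :=
  ProbabilityMeasure.tendsto_iff_forall_integral_tendsto.symm

/-- `T_P`: the set of `t` for which the projection `x ↦ x(t)` is continuous at `P`-almost
every `x`. -/
def projContSet (P : Measure SkorohodDD) : Set I :=
  {t | ∀ᵐ x ∂P, ContinuousAt (fun y : SkorohodDD => y t) x}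

/-- `T_X = {t | P(X(t) = X(t-)) = 1}`. By the definition of `Function.leftLim`, `X(0-) = X(0)`. -/
def noFixedJumpSet {Ω : Type*} [MeasurableSpace Ω] (ℙ : Measure Ω) (X : Ω → SkorohodDD) : Set I :=
  {t | ∀ᵐ ω ∂ℙ, X ω t = Function.leftLim (X ω) t}

/-- `lim_{δ → 0} limsup_n P_n(A(δ)) = 0`, where `δ` ranges over `(0, 1]`. -/
def LimLimsupZero {Ω : Type*} [MeasurableSpace Ω] (P : ℕ → Measure Ω) (A : ℕ → I → Set Ω) : Prop :=
  Tendsto (fun δ : I => limsup (fun n => P n (A n δ)) atTop) (𝓝[>] (0 : I)) (𝓝 0)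

end

/-! Both versions reduce to `convergesWeakly_of_finProj_of_modulusTwo`. A path is compared with the
step path that takes its values at finitely many fixed sampling times and switches between them at
fixed times. If w''_D is small at the scale of the mesh, then on each cell the path stays first near
its initial and then near its final sampled value (`exists_switch_point`). A piecewise linear time
change moves these path-dependent switches to the fixed ones
(`timeChangeDist_step_le_of_modulusTwo`). The only obstruction is a switch at time 1, which every
time change fixes; it is excluded when the last two sampled values are close.

On a fixed grid the sampled path is a Lipschitz function of a finite-dimensional projection, so
integrals of bounded Lipschitz functions of it converge as n grows. Under Q the grid can be refined
by dominated convergence. Along the sequence the sampling error is controlled by the modulus,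
together with a bounded continuous function of the last two samples whose integral passes to the
limit.

The sampling times must be times at which almost every path of the limit is left-continuous. All but
countably many times qualify (`countable_compl_leftContSet`): otherwise jumps of a fixed size would
occur with probability bounded below at infinitely many times, and some path would have infinitely
many of them. Time 1 qualifies by the condition on x(1) and x(1-δ). Separability of D makes the
projections Borel, and since d⁰ separates points, a left limit at distance zero from the value
equals it. -/

noncomputable section

/-! ### Piecewise linear time changes. -/

namespace TimeChange

/-- The length of the part of `[0, t]` that lies in `[a, b]`. -/
def clampLength (a b t : ℝ) : ℝ := min (max t a) b - a

lemma continuous_clampLength (a b : ℝ) : Continuous (clampLength a b) := by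
  unfold clampLength; fun_prop

lemma monotone_clampLength (a b : ℝ) : Monotone (clampLength a b) := fun s t h => by
  unfold clampLength; gcongr

lemma clampLength_of_le {a b t : ℝ} (hab : a ≤ b) (h : t ≤ a) : clampLength a b t = 0 := by
  simp [clampLength, h, hab]

lemma clampLength_of_ge {a b t : ℝ} (hab : a ≤ b) (h : b ≤ t) : clampLength a b t = b - a := by
  simp [clampLength, h, hab.trans h]

lemma sum_clampLength {u : ℕ → ℝ} {m : ℕ} (hu : MonotoneOn u (Iic m)) {t : ℝ} (ht : u 0 ≤ t) :
    ∑ i ∈ Finset.range m, clampLength (u i) (u (i + 1)) t = min t (u m) - u 0 := by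
  induction m with
  | zero => simp [ht]
  | succ k ih =>
    have h : u k ≤ u (k + 1) := hu (by simp) (by simp) (by simp)
    rw [Finset.sum_range_succ, ih (hu.mono (Iic_subset_Iic.2 (by simp)))]
    unfold clampLength
    rcases le_total t (u k) with h1 | h1
    · simp [h1, h1.trans h, h]
    · simp [h1]

/-- A node has each interval either entirely behind it or entirely ahead of it. -/
lemma sum_clampLength_node {u : ℕ → ℝ} {m j : ℕ} (hu : MonotoneOn u (Iic m)) (hj : j ≤ m)
    (r : ℕ → ℝ) :
    ∑ i ∈ Finset.range m, r i * clampLength (u i) (u (i + 1)) (u j) =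
      ∑ i ∈ Finset.range j, r i * (u (i + 1) - u i) := by
  have hs : Finset.range j ⊆ Finset.range m := Finset.range_subset_range.2 hj
  rw [← Finset.sum_subset hs]
  · refine Finset.sum_congr rfl fun i hi => ?_
    have hi := Finset.mem_range.1 hi
    rw [clampLength_of_ge]
    · exact hu (by simp; omega) (by simp; omega) (by omega)
    · exact hu (by simp; omega) (by simp; omega) (by omega)
  · intro i hi hi'
    simp only [Finset.mem_range, not_lt] at hi hi'
    rw [clampLength_of_le, mul_zero]
    · exact hu (by simp; omega) (by simp; omega) (by omega)
    · exact hu (by simp; omega) (by simp; omega) hi'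

/-- A piecewise linear time change with prescribed values at finitely many nodes. -/
theorem exists_piecewiseLinear {m : ℕ} {u v : ℕ → I} (hu : StrictMonoOn u (Iic m))
    (hu0 : u 0 = 0) (hu1 : u m = 1) (hv : StrictMonoOn v (Iic m)) (hv0 : v 0 = 0)
    (hv1 : v m = 1) :
    ∃ l : TimeChange, (∀ j ≤ m, l (u j) = v j) ∧ ∀ ε : ℝ,
      (∀ i < m, |Real.log (((v (i + 1) : ℝ) - v i) / ((u (i + 1) : ℝ) - u i))| ≤ ε) →
      logSlope l ≤ ENNReal.ofReal ε := by
  have hlt : ∀ i < m, (0 : ℝ) < u (i + 1) - u i := fun i hi => sub_pos.2 <| by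
    exact_mod_cast hu (by simp; omega) (by simp; omega) (Nat.lt_succ_self i)
  have hlt' : ∀ i < m, (0 : ℝ) < v (i + 1) - v i := fun i hi => sub_pos.2 <| by
    exact_mod_cast hv (by simp; omega) (by simp; omega) (Nat.lt_succ_self i)
  set r : ℕ → ℝ := fun i => ((v (i + 1) : ℝ) - v i) / ((u (i + 1) : ℝ) - u i) with hr
  have hrpos : ∀ i < m, 0 < r i := fun i hi => div_pos (hlt' i hi) (hlt i hi)
  have huM : MonotoneOn (fun i => (u i : ℝ)) (Iic m) := fun i hi j hj h => by
    exact_mod_cast hu.monotoneOn hi hj h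
  -- `g` integrates the slopes `r i`. Its increments are sums of nonnegative clamp increments
  -- weighted by `r i`, and the unweighted sums give `t - s`; so each difference quotient of `g` is
  -- a weighted average of the slopes and inherits their bounds.
  set g : ℝ → ℝ := fun t => ∑ i ∈ Finset.range m, r i * clampLength (u i) (u (i + 1)) t with hg
  have hgc : Continuous g := continuous_finsetSum _ fun i _ =>
    continuous_const.mul (continuous_clampLength _ _)
  have hnode : ∀ j ≤ m, g (u j) = v j := by
    intro j hj
    have h1 : g (u j) = ∑ i ∈ Finset.range j, r i * ((u (i + 1) : ℝ) - u i) :=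
      sum_clampLength_node (u := fun i => (u i : ℝ)) huM hj r
    have h2 : ∀ i ∈ Finset.range j, r i * ((u (i + 1) : ℝ) - u i) = (v (i + 1) : ℝ) - v i := by
      intro i hi
      exact div_mul_cancel₀ _ (hlt i (by have := Finset.mem_range.1 hi; omega)).ne'
    rw [h1, Finset.sum_congr rfl h2, Finset.sum_range_sub (fun i => (v i : ℝ)), hv0]
    simp
  have hsum : ∀ s t : I, ((t : ℝ) - s) = ∑ i ∈ Finset.range m,
      (clampLength (u i) (u (i + 1)) t - clampLength (u i) (u (i + 1)) s) := by
    intro s t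
    have h1 : ∀ t : I, ∑ i ∈ Finset.range m, clampLength (u i) (u (i + 1)) t = t := by
      intro t
      have := sum_clampLength (u := fun i => (u i : ℝ)) huM (t := (t : ℝ))
        (by simpa [hu0] using t.2.1)
      rw [this, hu1, hu0]
      simp [t.2.2]
    rw [Finset.sum_sub_distrib, h1, h1]
  have hdiff : ∀ s t : I, g t - g s = ∑ i ∈ Finset.range m,
      r i * (clampLength (u i) (u (i + 1)) t - clampLength (u i) (u (i + 1)) s) := by
    intro s t
    simp only [hg, mul_sub, Finset.sum_sub_distrib]
  have hcl : ∀ (s t : I), s ≤ t → ∀ i,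
      0 ≤ clampLength (u i) (u (i + 1)) t - clampLength (u i) (u (i + 1)) s := fun s t h i =>
    sub_nonneg.2 (monotone_clampLength _ _ (by exact_mod_cast h))
  have hgs : ∀ s t : I, s < t → g s < g t := by
    intro s t h
    rw [← sub_pos, hdiff]
    by_contra hneg
    have hnn : ∀ i ∈ Finset.range m,
        0 ≤ r i * (clampLength (u i) (u (i + 1)) t - clampLength (u i) (u (i + 1)) s) :=
      fun i hi => mul_nonneg (hrpos i (Finset.mem_range.1 hi)).le (hcl s t h.le i)
    have hz := (Finset.sum_eq_zero_iff_of_nonneg hnn).1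
      (le_antisymm (not_lt.1 hneg) (Finset.sum_nonneg hnn))
    have hst : (t : ℝ) - s = 0 := by
      rw [hsum s t]
      refine Finset.sum_eq_zero fun i hi => ?_
      exact (mul_eq_zero.1 (hz i hi)).resolve_left (hrpos i (Finset.mem_range.1 hi)).ne'
    have : (s : ℝ) < t := by exact_mod_cast h
    linarith
  have hg0 : g 0 = 0 := by simpa [hu0, hv0] using hnode 0 (by simp)
  have hg1 : g 1 = 1 := by simpa [hu1, hv1] using hnode m le_rfl
  have hgmono : Monotone fun t : I => g t :=
    StrictMono.monotone (f := fun t : I => g t) fun s t h => hgs s t h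
  have hgI : ∀ t : I, g t ∈ I := fun t =>
    ⟨by simpa [hg0] using hgmono (bot_le : (0 : I) ≤ t),
      by simpa [hg1] using hgmono (le_top : t ≤ (1 : I))⟩
  let G : I → I := fun t => ⟨g t, hgI t⟩
  have hGs : StrictMono G := fun s t h => Subtype.mk_lt_mk.2 (hgs s t h)
  have hGc : Continuous G := Continuous.subtype_mk (hgc.comp continuous_subtype_val) _
  have hGsurj : Function.Surjective G := fun y =>
    mem_range_of_exists_le_of_exists_ge hGc
      ⟨0, by rw [← Subtype.coe_le_coe]; simpa [G, hg0] using y.2.1⟩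
      ⟨1, by rw [← Subtype.coe_le_coe]; simpa [G, hg1] using y.2.2⟩
  refine ⟨StrictMono.orderIsoOfSurjective G hGs hGsurj, fun j hj => ?_, fun ε hε => ?_⟩
  · exact Subtype.ext (hnode j hj)
  · refine iSup_le fun s => iSup_le fun t => iSup_le fun h => ENNReal.ofReal_le_ofReal ?_
    change |Real.log ((g t - g s) / ((t : ℝ) - s))| ≤ ε
    have hst : (0 : ℝ) < (t : ℝ) - s := sub_pos.2 (by exact_mod_cast h)
    have hgst : 0 < g t - g s := sub_pos.2 (hgs s t h)
    have hri : ∀ i < m, Real.exp (-ε) ≤ r i ∧ r i ≤ Real.exp ε := fun i hi => by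
      have := abs_le.1 (hε i hi)
      exact ⟨(Real.le_log_iff_exp_le (hrpos i hi)).1 this.1,
        (Real.log_le_iff_le_exp (hrpos i hi)).1 this.2⟩
    rw [abs_le, Real.le_log_iff_exp_le (by positivity), Real.log_le_iff_le_exp (by positivity),
      le_div_iff₀ hst, div_le_iff₀ hst, hdiff s t, hsum s t, Finset.mul_sum, Finset.mul_sum]
    exact ⟨Finset.sum_le_sum fun i hi => mul_le_mul_of_nonneg_right
        (hri i (Finset.mem_range.1 hi)).1 (hcl s t h.le i),
      Finset.sum_le_sum fun i hi => mul_le_mul_of_nonneg_right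
        (hri i (Finset.mem_range.1 hi)).2 (hcl s t h.le i)⟩

end TimeChange

/-! ### Step functions and the oscillation of càdlàg functions. -/

namespace Cadlag

section Step

/-- The number of the nodes `c 0, …, c (m - 1)` that are at most `t`. -/
def stepCount (m : ℕ) (c : ℕ → I) (t : I) : ℕ := ((Finset.range m).filter (fun j => c j ≤ t)).card

lemma stepCount_le (m : ℕ) (c : ℕ → I) (t : I) : stepCount m c t ≤ m := by
  exact (Finset.card_filter_le _ _).trans (Finset.card_range m).le

/-- An order automorphism preserves the comparisons being counted. This is what aligns two step
functions with different nodes. -/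
lemma stepCount_orderIso (m : ℕ) {c c' : ℕ → I} (l : TimeChange) (h : ∀ j < m, l (c j) = c' j)
    (t : I) : stepCount m c' (l t) = stepCount m c t := by
  unfold stepCount
  congr 1
  refine Finset.filter_congr fun j hj => ?_
  rw [← h j (Finset.mem_range.1 hj), l.le_iff_le]

/-- For monotone nodes the indices counted form an initial segment, so the count is the index of the
first node past `t`. -/
lemma stepCount_spec {m : ℕ} {c : ℕ → I} (hc : MonotoneOn c (Iio m)) (t : I) :
    (∀ j < stepCount m c t, c j ≤ t) ∧ ∀ j, stepCount m c t ≤ j → j < m → t < c j := by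
  classical
  have hex : ∃ i, m ≤ i ∨ t < c i := ⟨m, Or.inl le_rfl⟩
  set i := Nat.find hex with hi
  have him : i ≤ m := Nat.find_min' hex (Or.inl le_rfl)
  have h1 : ∀ j < i, c j ≤ t := fun j hj => by
    have := Nat.find_min hex hj
    push Not at this
    exact this.2
  have h2 : ∀ j, i ≤ j → j < m → t < c j := fun j hj hjm => by
    rcases Nat.find_spec hex with h | h
    · omega
    · exact h.trans_le (hc (show i < m from hj.trans_lt hjm) hjm hj)
  have h3 : stepCount m c t = i := by
    have : (Finset.range m).filter (fun j => c j ≤ t) = Finset.range i := by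
      ext j
      simp only [Finset.mem_filter, Finset.mem_range]
      refine ⟨fun h => ?_, fun h => ⟨by omega, h1 j h⟩⟩
      by_contra hj
      exact (h2 j (not_lt.1 hj) h.1).not_ge h.2
    rw [stepCount, this, Finset.card_range]
  rw [h3]
  exact ⟨h1, h2⟩

/-- The step function with nodes `c 0, …, c (m - 1)` and values `a 0, …, a m`. -/
def step {S : Type*} [TopologicalSpace S] (m : ℕ) (c : ℕ → I) (a : ℕ → S) : Cadlag S where
  toFun t := a (stepCount m c t)
  rightCts' t := by
    have h : ∀ᶠ s in 𝓝[≥] t, a (stepCount m c s) = a (stepCount m c t) := by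
      have h1 : ∀ᶠ s in 𝓝[≥] t, ∀ j ∈ Finset.range m, (c j ≤ s ↔ c j ≤ t) := by
        refine (Finset.eventually_all _).2 fun j _ => ?_
        rcases le_or_gt (c j) t with h | h
        · filter_upwards [self_mem_nhdsWithin] with s hs
          exact ⟨fun _ => h, fun _ => h.trans hs⟩
        · filter_upwards [mem_nhdsWithin_of_mem_nhds (Iio_mem_nhds h)] with s hs
          exact ⟨fun h' => absurd h' (not_le.2 hs), fun h' => absurd h' (not_le.2 h)⟩
      filter_upwards [h1] with s hs
      rw [stepCount, stepCount, Finset.filter_congr hs]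
    exact tendsto_const_nhds.congr' (h.mono fun s hs => hs.symm)
  leftLim' t := by
    -- Just to the left of `t`, a node equal to `t` has not been passed yet; hence the strict
    -- inequality.
    refine ⟨a ((Finset.range m).filter (fun j => c j < t)).card, ?_⟩
    have h1 : ∀ᶠ s in 𝓝[<] t, ∀ j ∈ Finset.range m, (c j ≤ s ↔ c j < t) := by
      refine (Finset.eventually_all _).2 fun j _ => ?_
      rcases lt_or_ge (c j) t with h | h
      · filter_upwards [mem_nhdsWithin_of_mem_nhds (Ioi_mem_nhds h)] with s hs
        exact ⟨fun _ => h, fun _ => le_of_lt hs⟩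
      · filter_upwards [self_mem_nhdsWithin] with s hs
        exact ⟨fun h' => absurd (h.trans h') (not_le.2 hs), fun h' => absurd h' (not_lt.2 h)⟩
    refine tendsto_const_nhds.congr' (h1.mono fun s hs => ?_)
    simp only [stepCount, Finset.filter_congr hs]

lemma step_apply {S : Type*} [TopologicalSpace S] (m : ℕ) (c : ℕ → I) (a : ℕ → S) (t : I) :
    step m c a t = a (stepCount m c t) := rfl

end Step

variable {S : Type*} [PseudoEMetricSpace S]

/-- Up to `ε`, a càdlàg function varies only at finitely many points. -/
theorem exists_finset_edist_le (x : Cadlag S) {ε : ℝ≥0∞} (hε : ε ≠ 0) :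
    ∃ F : Finset ℝ, ∀ s t : I, s ≤ t → (∀ p ∈ F, ¬((s : ℝ) < p ∧ p ≤ t)) →
      edist (x s) (x t) ≤ ε := by
  classical
  have hε2 : 0 < ε / 2 := ENNReal.half_pos hε
  have key : ∀ τ : I, ∃ r : ℝ, 0 < r ∧ ∀ s t : I, |(s : ℝ) - τ| < r → |(t : ℝ) - τ| < r →
      (τ ≤ s ∧ τ ≤ t ∨ s < τ ∧ t < τ) → edist (x s) (x t) ≤ ε := by
    intro τ
    obtain ⟨l, hl⟩ := x.leftLim' τ
    have h1 := (x.rightCts' τ).eventually (Metric.eball_mem_nhds _ hε2)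
    have h2 := hl.eventually (Metric.eball_mem_nhds _ hε2)
    rw [Metric.nhdsWithin_basis_ball.eventually_iff] at h1 h2
    obtain ⟨r1, hr1, h1⟩ := h1
    obtain ⟨r2, hr2, h2⟩ := h2
    have tri : ∀ a b c : S, edist a c < ε / 2 → edist b c < ε / 2 → edist a b ≤ ε := by
      intro a b c ha hb
      calc edist a b ≤ edist a c + edist b c := edist_triangle_right _ _ _
        _ ≤ ε / 2 + ε / 2 := add_le_add ha.le hb.le
        _ = ε := ENNReal.add_halves ε
    refine ⟨min r1 r2, lt_min hr1 hr2, fun s t hs ht h => ?_⟩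
    rcases h with h | h
    · exact tri _ _ _ (h1 ⟨hs.trans_le (min_le_left _ _), h.1⟩)
        (h1 ⟨ht.trans_le (min_le_left _ _), h.2⟩)
    · exact tri _ _ _ (h2 ⟨hs.trans_le (min_le_right _ _), h.1⟩)
        (h2 ⟨ht.trans_le (min_le_right _ _), h.2⟩)
  choose r hr hosc using key
  obtain ⟨T, -, hT⟩ := (isCompact_univ (X := I)).elim_nhds_subcover
    (fun τ => Metric.ball τ (r τ)) (fun τ _ => Metric.ball_mem_nhds τ (hr τ))
  -- Centres and right endpoints of a finite subcover suffice. If `s` lies in the ball at `τ` and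
  -- `(s, t]` avoids these points, then `t` stays in the ball, on the same side of `τ` as `s`. Left
  -- endpoints do not matter because `s ≤ t`.
  refine ⟨T.biUnion fun τ => {(τ : ℝ), τ + r τ}, fun s t hst hp => ?_⟩
  have hst' : (s : ℝ) ≤ t := by exact_mod_cast hst
  obtain ⟨τ, hτ, hs⟩ := mem_iUnion₂.1 (hT (mem_univ s))
  have hs : |(s : ℝ) - τ| < r τ := hs
  have hs' := abs_lt.1 hs
  have p1 := hp τ (Finset.mem_biUnion.2 ⟨τ, hτ, by simp⟩)
  have p2 := hp (τ + r τ) (Finset.mem_biUnion.2 ⟨τ, hτ, by simp⟩)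
  have ht : (t : ℝ) < τ + r τ := by
    by_contra h
    exact p2 ⟨by linarith, not_lt.1 h⟩
  refine hosc τ s t hs (abs_lt.2 ⟨by linarith, by linarith⟩) ?_
  rcases lt_or_ge s τ with h | h
  · refine Or.inr ⟨h, ?_⟩
    by_contra h'
    exact p1 ⟨by exact_mod_cast h, by exact_mod_cast not_lt.1 h'⟩
  · exact Or.inl ⟨h, h.trans hst⟩

/-- All but finitely many points carry no left jump larger than `ε`. -/
theorem finite_large_jumps (x : Cadlag S) {ε : ℝ≥0∞} (hε : ε ≠ 0) :
    {t : I | ¬ ∀ᶠ s in 𝓝[<] t, edist (x s) (x t) ≤ ε}.Finite := by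
  obtain ⟨F, hF⟩ := x.exists_finset_edist_le hε
  refine (F.finite_toSet.preimage (f := ((↑) : I → ℝ)) Subtype.val_injective.injOn).subset ?_
  intro t ht
  by_contra htF
  refine ht ?_
  have h1 : ∀ᶠ s : I in 𝓝[<] t, ∀ p ∈ F, ¬((s : ℝ) < p ∧ p ≤ t) := by
    refine (Finset.eventually_all _).2 fun p hp => ?_
    rcases lt_trichotomy p (t : ℝ) with h | h | h
    · have : ∀ᶠ s : I in 𝓝 t, p < (s : ℝ) :=
        continuous_subtype_val.continuousAt.eventually (Ioi_mem_nhds h)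
      filter_upwards [mem_nhdsWithin_of_mem_nhds this] with s hs h'
      exact lt_asymm hs h'.1
    · exact absurd (show (t : ℝ) ∈ F from h ▸ hp) htF
    · exact Eventually.of_forall fun s h' => h'.2.not_gt h
  filter_upwards [h1, self_mem_nhdsWithin] with s hs hst
  exact hF s t (le_of_lt hst) hs

/-- Take `δ` below all gaps between exceptional points. Then at most one of `(t₁, t]` and `(t, t₂]`
contains such a point, and the oscillation over the other is small. -/
theorem exists_modulusTwo_lt (x : Cadlag S) {ε : ℝ≥0∞} (hε : ε ≠ 0) :
    ∃ δ : ℝ, 0 < δ ∧ modulusTwo x δ < ε := by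
  obtain ⟨ε', h0, hε'⟩ := exists_between (pos_iff_ne_zero.2 hε)
  obtain ⟨F, hF⟩ := x.exists_finset_edist_le h0.ne'
  have hgap : ∃ δ : ℝ, 0 < δ ∧ ∀ p ∈ F, ∀ q ∈ F, p < q → δ < q - p := by
    have : ∀ᶠ δ in 𝓝[>] (0 : ℝ), ∀ p ∈ F, ∀ q ∈ F, p < q → δ < q - p := by
      refine (Finset.eventually_all _).2 fun p _ => (Finset.eventually_all _).2 fun q _ => ?_
      rcases lt_or_ge p q with h | h
      · filter_upwards [mem_nhdsWithin_of_mem_nhds (Iio_mem_nhds (sub_pos.2 h))] with δ hδ _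
        exact hδ
      · exact Eventually.of_forall fun δ h' => absurd h' (not_lt.2 h)
    obtain ⟨δ, h1, h2⟩ := (this.and self_mem_nhdsWithin).exists
    exact ⟨δ, h2, h1⟩
  obtain ⟨δ, hδ, hgap⟩ := hgap
  refine ⟨δ, hδ, lt_of_le_of_lt ?_ hε'⟩
  refine iSup_le fun t₁ => iSup_le fun t => iSup_le fun t₂ => iSup_le fun h => ?_
  by_cases hc : ∀ p ∈ F, ¬((t₁ : ℝ) < p ∧ p ≤ t)
  · exact min_le_of_left_le (by rw [edist_comm]; exact hF _ _ h.1 hc)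
  · push Not at hc
    obtain ⟨p, hp, hp1, hp2⟩ := hc
    rw [edist_comm (x t₂)]
    refine min_le_of_right_le (hF _ _ h.2.1 fun q hq hq' => ?_)
    have := hgap p hp q hq (by linarith)
    linarith [h.2.2]

/-- The nodes are the exceptional points of `exists_finset_edist_le` together with 0 and 1, in
increasing order. -/
theorem exists_partition (x : Cadlag S) {ε : ℝ≥0∞} (hε : ε ≠ 0) :
    ∃ (m : ℕ) (u : ℕ → I), StrictMonoOn u (Iic m) ∧ u 0 = 0 ∧ u m = 1 ∧
      ∀ i < m, ∀ t, u i ≤ t → t < u (i + 1) → edist (x (u i)) (x t) ≤ ε := by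
  classical
  obtain ⟨F, hF⟩ := x.exists_finset_edist_le hε
  set G : Finset I := insert 0 (insert 1 (F.preimage ((↑) : I → ℝ) Subtype.val_injective.injOn))
    with hG
  have hG0 : (0 : I) ∈ G := by simp [hG]
  have hG1 : (1 : I) ∈ G := by simp [hG]
  obtain ⟨m, hm⟩ : ∃ m, G.card = m + 1 :=
    Nat.exists_eq_succ_of_ne_zero (Finset.card_ne_zero_of_mem hG0)
  set e := G.orderEmbOfFin hm with he
  have hrange : ∀ p ∈ G, ∃ j, e j = p := fun p hp => by
    have : p ∈ Set.range e := by rw [he, Finset.range_orderEmbOfFin]; exact hp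
    exact this
  let u : ℕ → I := fun j => if h : j < m + 1 then e ⟨j, h⟩ else 1
  have hu : ∀ j (h : j < m + 1), u j = e ⟨j, h⟩ := fun j h => dif_pos h
  refine ⟨m, u, ?_, ?_, ?_, ?_⟩
  · intro i hi j hj hij
    have hi : i ≤ m := hi
    have hj : j ≤ m := hj
    rw [hu i (by omega), hu j (by omega)]
    exact e.strictMono (by simpa using hij)
  · rw [hu 0 (by omega)]
    obtain ⟨j, hj⟩ := hrange 0 hG0
    exact le_antisymm (hj ▸ e.monotone (Fin.mk_le_of_le_val (Nat.zero_le _))) bot_le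
  · rw [hu m (by omega)]
    obtain ⟨j, hj⟩ := hrange 1 hG1
    exact le_antisymm le_top (hj ▸ e.monotone (Fin.le_def.2 (Nat.lt_succ_iff.1 j.2)))
  · intro i hi t h1 h2
    rw [hu (i + 1) (by omega)] at h2
    refine hF _ _ h1 fun p hp hp' => ?_
    rw [hu i (by omega)] at hp'
    have hpI : p ∈ I := ⟨(e ⟨i, by omega⟩).2.1.trans hp'.1.le, hp'.2.trans t.2.2⟩
    obtain ⟨j, hj⟩ := hrange ⟨p, hpI⟩ (by simp [hG, hp])
    have hp'1 : e ⟨i, by omega⟩ < e j := by rw [hj, ← Subtype.coe_lt_coe]; exact hp'.1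
    have hp'2 : e j < e ⟨i + 1, by omega⟩ := by
      refine lt_of_le_of_lt ?_ h2
      rw [hj, ← Subtype.coe_le_coe]
      exact hp'.2
    rw [e.lt_iff_lt, Fin.lt_def] at hp'1 hp'2
    simp only at hp'1 hp'2
    omega

/-- Once `l` matches the nodes, values are compared index by index. The length `N` is left general
because both `logSlope` and `distId` are needed. -/
lemma timeChangeDist_step_le (N : TimeChange → ℝ≥0∞) {m : ℕ} {c c' : ℕ → I} {a a' : ℕ → S}
    (l : TimeChange) (hl : ∀ j < m, l (c j) = c' j) {ε : ℝ≥0∞} (hN : N l ≤ ε)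
    (ha : ∀ i ≤ m, edist (a i) (a' i) ≤ ε) :
    timeChangeDist N (step m c a) (step m c' a') ≤ ε := by
  refine iInf_le_of_le l (max_le hN (iSup_le fun t => ?_))
  rw [step_apply, step_apply, stepCount_orderIso m l hl]
  exact ha _ (stepCount_le _ _ _)

end Cadlag

lemma Cadlag.ext_fun {S : Type*} [TopologicalSpace S] {x y : Cadlag S} (h : ∀ t, x t = y t) :
    x = y := by
  cases x; cases y
  congr
  exact funext h

/-! ### Separability of D, and separation of points by d⁰. -/

namespace SkorohodD

/-- Strictly increasing nodes `u 0 = 0, …, u m = 1`. -/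
def Nodes (m : ℕ) : Type := {u : ℕ → I // StrictMonoOn u (Iic m) ∧ u 0 = 0 ∧ u m = 1}

instance (m : ℕ) : TopologicalSpace (Nodes m) :=
  inferInstanceAs (TopologicalSpace {u : ℕ → I // StrictMonoOn u (Iic m) ∧ u 0 = 0 ∧ u m = 1})

instance (m : ℕ) : SecondCountableTopology (Nodes m) :=
  TopologicalSpace.Subtype.secondCountableTopology
    {u : ℕ → I | StrictMonoOn u (Iic m) ∧ u 0 = 0 ∧ u m = 1}

/-- The step function in `D` determined by its nodes and values. -/
def stepOf (m : ℕ) (p : Nodes m × (ℕ → ℝ)) : SkorohodD := Cadlag.step (m + 1) p.1.1 p.2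

/-- The log-slopes of the piecewise linear map between two sets of nodes depend continuously on the
nodes and vanish when the sets agree. Continuity on a second countable parameter space makes the
range separable. -/
lemma continuous_stepOf (m : ℕ) : Continuous (stepOf m) := by
  refine continuous_iff_continuousAt.2 fun p => EMetric.tendsto_nhds.2 fun ε hε => ?_
  obtain ⟨η, -, hη0, hη⟩ := ENNReal.lt_iff_exists_real_btwn.1 hε
  have hη0 : 0 < η := ENNReal.ofReal_pos.1 hη0
  have hpos : ∀ i < m, (0 : ℝ) < p.1.1 (i + 1) - p.1.1 i := fun i hi => sub_pos.2 <| by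
    exact_mod_cast p.1.2.1 (show i ≤ m by omega) (show i + 1 ≤ m by omega) (Nat.lt_succ_self i)
  have hcoord : ∀ i, Continuous fun q : Nodes m × (ℕ → ℝ) => (q.1.1 i : ℝ) := fun i =>
    continuous_subtype_val.comp ((continuous_apply i).comp
      ((continuous_subtype_val (p := fun u : ℕ → I =>
        StrictMonoOn u (Iic m) ∧ u 0 = 0 ∧ u m = 1)).comp continuous_fst))
  have h1 : ∀ᶠ q in 𝓝 p, ∀ i ∈ Finset.range m,
      |Real.log (((q.1.1 (i + 1) : ℝ) - q.1.1 i) / ((p.1.1 (i + 1) : ℝ) - p.1.1 i))| ≤ η := by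
    refine (Finset.eventually_all _).2 fun i hi => ?_
    have hi := hpos i (Finset.mem_range.1 hi)
    have hc : ContinuousAt (fun q : Nodes m × (ℕ → ℝ) =>
        |Real.log (((q.1.1 (i + 1) : ℝ) - q.1.1 i) / ((p.1.1 (i + 1) : ℝ) - p.1.1 i))|) p :=
      ContinuousAt.abs <| ContinuousAt.log
        (((hcoord (i + 1)).sub (hcoord i)).div_const _).continuousAt (div_pos hi hi).ne'
    have := hc.eventually_lt (g := fun _ => η) continuousAt_const
      (by simpa [div_self hi.ne'] using hη0)
    exact this.mono fun q hq => le_of_lt hq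
  have h2 : ∀ᶠ q in 𝓝 p, ∀ i ∈ Finset.range (m + 2),
      edist (p.2 i) (q.2 i) ≤ ENNReal.ofReal η := by
    refine (Finset.eventually_all _).2 fun i _ => ?_
    have hc : Continuous fun q : Nodes m × (ℕ → ℝ) => q.2 i :=
      (continuous_apply i).comp continuous_snd
    filter_upwards [hc.continuousAt.eventually
      (Metric.eball_mem_nhds _ (ENNReal.ofReal_pos.2 hη0))] with q hq
    rw [edist_comm]
    exact le_of_lt hq
  filter_upwards [h1, h2] with q hq1 hq2
  obtain ⟨l, hl, hls⟩ := TimeChange.exists_piecewiseLinear p.1.2.1 p.1.2.2.1 p.1.2.2.2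
    q.1.2.1 q.1.2.2.1 q.1.2.2.2
  refine lt_of_le_of_lt ?_ hη
  rw [edist_comm]
  exact Cadlag.timeChangeDist_step_le TimeChange.logSlope l (fun j hj => hl j (by omega))
    (hls η fun i hi => hq1 i (Finset.mem_range.2 hi))
    fun i hi => hq2 i (Finset.mem_range.2 (by omega))

lemma exists_edist_stepOf_le (x : SkorohodD) {ε : ℝ≥0∞} (hε : ε ≠ 0) :
    ∃ m p, edist x (stepOf m p) ≤ ε := by
  obtain ⟨m, u, hu, hu0, hu1, hosc⟩ := x.exists_partition hε
  -- The node `u 0 = 0` is always counted, so the count on `[u i, u (i + 1))` is `i + 1`; hence the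
  -- shift by one.
  refine ⟨m, (⟨u, hu, hu0, hu1⟩, fun i => x (u (i - 1))),
    iInf_le_of_le (OrderIso.refl I) (max_le ?_ (iSup_le fun t => ?_))⟩
  · simp [TimeChange.logSlope_refl]
  have hspec := Cadlag.stepCount_spec (m := m + 1) (c := u)
    (hu.monotoneOn.mono fun i hi => Nat.lt_succ_iff.1 hi) t
  have hle := Cadlag.stepCount_le (m + 1) u t
  change edist (x t) (x (u (Cadlag.stepCount (m + 1) u t - 1))) ≤ ε
  generalize Cadlag.stepCount (m + 1) u t = i at hspec hle ⊢
  obtain ⟨hs1, hs2⟩ := hspec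
  rcases i with _ | i
  · exact absurd (hs2 0 le_rfl (by omega)) (by simp [hu0])
  · have h1 : u i ≤ t := hs1 i (by omega)
    rw [Nat.add_sub_cancel]
    rcases Nat.lt_or_ge i m with h | h
    · rw [edist_comm]
      exact hosc i h t h1 (hs2 (i + 1) le_rfl (by omega))
    · obtain rfl : i = m := by omega
      have : t = u i := le_antisymm (by rw [hu1]; exact le_top) h1
      simp [this]

/-- Second countability gives `D^k` the product of the Borel σ-fields and makes the distance jointly
measurable, as the measurability of projections and of jump events requires. -/
instance : SecondCountableTopology SkorohodD := by
  have h1 : TopologicalSpace.IsSeparable (closure (⋃ m, range (stepOf m))) :=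
    (TopologicalSpace.IsSeparable.iUnion fun m =>
      TopologicalSpace.isSeparable_range (continuous_stepOf m)).closure
  have h2 : closure (⋃ m, range (stepOf m)) = univ := by
    refine eq_univ_of_forall fun x => EMetric.mem_closure_iff.2 fun ε hε => ?_
    obtain ⟨ε', h0, h1⟩ := exists_between hε
    obtain ⟨m, p, hp⟩ := exists_edist_stepOf_le x h0.ne'
    exact ⟨_, mem_iUnion.2 ⟨m, p, rfl⟩, hp.trans_lt h1⟩
  rw [h2, TopologicalSpace.isSeparable_univ_iff] at h1
  exact UniformSpace.secondCountable_of_separable _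

/-- At `t` itself a time change could move the argument to the left, where nothing is known. The
comparison is therefore made at a point `s` slightly to the right of `t`: comparing slopes with 0
gives `s * exp (-η) ≤ l s ≤ s * exp η`, so for small `η` both `s` and `l s` stay where
right-continuity applies. -/
lemma eq_of_edist_eq_zero {x y : SkorohodD} (h : edist x y = 0) : x = y := by
  have key : ∀ η : ℝ, 0 < η → ∃ l : TimeChange, TimeChange.logSlope l ≤ ENNReal.ofReal η ∧
      ∀ t, |x t - y (l t)| ≤ η := by
    intro η hη
    have : timeChangeDist TimeChange.logSlope x y < ENNReal.ofReal η := by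
      change edist x y < _
      rw [h]
      exact ENNReal.ofReal_pos.2 hη
    obtain ⟨l, hl⟩ := iInf_lt_iff.1 this
    refine ⟨l, (le_max_left _ _).trans hl.le, fun t => ?_⟩
    have h1 := (le_iSup (fun t : I => edist (x t) (y (l t))) t).trans
      ((le_max_right _ _).trans hl.le)
    rwa [edist_dist, ENNReal.ofReal_le_ofReal_iff hη.le] at h1
  refine Cadlag.ext_fun fun t => eq_of_abs_sub_le_all fun ε hε => ?_
  rcases eq_or_lt_of_le (show t ≤ 1 from le_top) with rfl | ht
  · obtain ⟨l, -, hl⟩ := key ε hε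
    have h1 : l 1 = 1 := l.map_top
    simpa [h1] using hl 1
  have hx := (x.rightCts' t).eventually (Metric.ball_mem_nhds _ (show 0 < ε / 3 by positivity))
  have hy := (y.rightCts' t).eventually (Metric.ball_mem_nhds _ (show 0 < ε / 3 by positivity))
  obtain ⟨b, hb, hball⟩ := (mem_nhdsGE_iff_exists_Ico_subset' ht).1 (hx.and hy)
  obtain ⟨s, hts, hsb⟩ := exists_between (show t < b from hb)
  have hts' : (t : ℝ) < s := by exact_mod_cast hts
  have hs0 : (0 : ℝ) < s := lt_of_le_of_lt t.2.1 hts'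
  have hev : ∀ᶠ η in 𝓝[>] (0 : ℝ), (t : ℝ) < s * Real.exp (-η) ∧ s * Real.exp η < b ∧
      η < ε / 3 := by
    have c1 : Continuous fun η : ℝ => (s : ℝ) * Real.exp (-η) := by fun_prop
    have c2 : Continuous fun η : ℝ => (s : ℝ) * Real.exp η := by fun_prop
    refine ((c1.tendsto 0).eventually (Ioi_mem_nhds (by simpa using hts'))).filter_mono
      nhdsWithin_le_nhds |>.and ?_
    refine (c2.continuousAt (x := 0)).eventually_lt (g := fun _ => (b : ℝ)) continuousAt_const
      (by simpa using hsb) |>.filter_mono nhdsWithin_le_nhds |>.and ?_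
    exact mem_nhdsWithin_of_mem_nhds (Iio_mem_nhds (by positivity))
  obtain ⟨η, ⟨hη1, hη2, hη3⟩, hη0⟩ := (hev.and self_mem_nhdsWithin).exists
  have hη0 : 0 < η := hη0
  obtain ⟨l, hl, hxy⟩ := key η hη0
  have h0s : (0 : I) < s := by exact_mod_cast hs0
  have hls := (TimeChange.le_logSlope l h0s).trans hl
  have hl0 : l 0 = 0 := l.map_bot
  have hlpos : (0 : ℝ) < l s := by
    have := l.strictMono h0s
    rw [hl0] at this
    exact_mod_cast this
  rw [ENNReal.ofReal_le_ofReal_iff hη0.le, hl0] at hls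
  simp only [Icc.coe_zero, sub_zero] at hls
  rw [abs_le, Real.le_log_iff_exp_le (by positivity), Real.log_le_iff_le_exp (by positivity),
    le_div_iff₀ hs0, div_le_iff₀ hs0] at hls
  have m1 := hball ⟨hts.le, hsb⟩
  have m2 := hball (show l s ∈ Ico t b from
    ⟨by rw [← Subtype.coe_le_coe]; nlinarith [hls.1], by
      rw [← Subtype.coe_lt_coe]; nlinarith [hls.2]⟩)
  have a1 : |x s - x t| < ε / 3 := m1.1
  have a2 : |y (l s) - y t| < ε / 3 := m2.2
  have a3 := hxy s
  rw [abs_lt] at a1 a2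
  rw [abs_le] at a3 ⊢
  constructor <;> linarith [a1.1, a1.2, a2.1, a2.2, a3.1, a3.2]

instance : T0Space SkorohodD :=
  ⟨fun _ _ h => eq_of_edist_eq_zero (EMetric.inseparable_iff.1 h)⟩

instance : T2Space SkorohodD := inferInstance

end SkorohodD

/-! ### Approximation by step functions with prescribed nodes. -/

namespace TimeChange

/-- A time change moving prescribed interior nodes to prescribed interior nodes. -/
theorem exists_map_interior {m : ℕ} {c c' : ℕ → I} (hc : StrictMonoOn c (Iio m))
    (hc' : StrictMonoOn c' (Iio m)) (h : ∀ j < m, c j ∈ Ioo 0 1) (h' : ∀ j < m, c' j ∈ Ioo 0 1) :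
    ∃ l : TimeChange, ∀ j < m, l (c j) = c' j := by
  -- The interior nodes are shifted by one index to make room for the endpoints 0 and 1.
  let ext : (ℕ → I) → ℕ → I := fun c i => if i = 0 then 0 else if i ≤ m then c (i - 1) else 1
  have hext : ∀ c : ℕ → I, StrictMonoOn c (Iio m) → (∀ j < m, c j ∈ Ioo 0 1) →
      StrictMonoOn (ext c) (Iic (m + 1)) := by
    intro c hc hc1 i hi j hj hij
    have hi : i ≤ m + 1 := hi
    have hj : j ≤ m + 1 := hj
    simp only [ext]
    rw [if_neg (show j ≠ 0 by omega)]
    rcases Nat.eq_zero_or_pos i with h1 | h1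
    · rw [if_pos h1]
      split_ifs with h2
      · exact (hc1 _ (by omega)).1
      · exact zero_lt_one
    · rw [if_neg (by omega), if_pos (show i ≤ m by omega)]
      split_ifs with h2
      · exact hc (show i - 1 < m by omega) (show j - 1 < m by omega) (by omega)
      · exact (hc1 _ (by omega)).2
  obtain ⟨l, hl, -⟩ := exists_piecewiseLinear (hext c hc h) (by simp [ext]) (by simp [ext])
    (hext c' hc' h') (by simp [ext]) (by simp [ext])
  refine ⟨l, fun j hj => ?_⟩
  have := hl (j + 1) (by omega)
  simpa [ext, Nat.succ_le_of_lt hj] using this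

end TimeChange

namespace Cadlag

variable {S : Type*} [PseudoEMetricSpace S]

lemma min_edist_le_modulusTwo (x : I → S) {δ : ℝ} {t₁ t t₂ : I} (h1 : t₁ ≤ t) (h2 : t ≤ t₂)
    (h : (t₂ : ℝ) - t₁ ≤ δ) : min (edist (x t) (x t₁)) (edist (x t₂) (x t)) ≤ modulusTwo x δ :=
  le_iSup_of_le t₁ (le_iSup_of_le t (le_iSup_of_le t₂ (le_iSup_of_le ⟨h1, h2, h⟩ le_rfl)))

/-- If the modulus is small, then on a short interval `x` is first close to its initial and then
close to its final value. -/
theorem exists_switch_point (x : Cadlag S) {δ : ℝ} {ε : ℝ≥0∞} {a b : I} (hab : a < b)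
    (hδ : (b : ℝ) - a ≤ δ) (hw : modulusTwo x δ < ε) :
    ∃ c, a < c ∧ c ≤ b ∧ (∀ s, a ≤ s → s < c → edist (x s) (x a) ≤ 4 * ε) ∧
      (∀ s, c ≤ s → s ≤ b → edist (x s) (x b) ≤ 4 * ε) ∧ (edist (x b) (x a) < ε → c < b) := by
  have hmod : ∀ s t u, a ≤ s → s ≤ t → t ≤ u → u ≤ b →
      edist (x t) (x s) < ε ∨ edist (x u) (x t) < ε := fun s t u h1 h2 h3 h4 => by
    refine min_lt_iff.1 ((min_edist_le_modulusTwo x h2 h3 ?_).trans_lt hw)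
    have : (u : ℝ) ≤ b := by exact_mod_cast h4
    have : (a : ℝ) ≤ s := by exact_mod_cast h1
    linarith
  have e2 : ε + ε = 2 * ε := (two_mul ε).symm
  have e4 : 2 * ε + 2 * ε = 4 * ε := by rw [← add_mul]; norm_num
  have e12 : ε ≤ 2 * ε := e2 ▸ le_self_add
  have e24 : 2 * ε ≤ 4 * ε := e4 ▸ le_self_add
  -- If the end values are close, any interior point can serve as the switch, and it can be kept
  -- strictly below `b`.
  by_cases hclose : edist (x b) (x a) < ε
  · obtain ⟨c, hac, hcb⟩ := exists_between hab
    refine ⟨c, hac, hcb.le, fun s h1 h2 => ?_, fun s h1 h2 => ?_, fun _ => hcb⟩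
    · rcases hmod a s b le_rfl h1 (h2.le.trans hcb.le) le_rfl with h | h
      · exact h.le.trans (e12.trans e24)
      · refine ((edist_triangle_left (x s) (x a) (x b)).trans ?_).trans (e2.le.trans e24)
        exact add_le_add h.le hclose.le
    · rcases hmod a s b le_rfl (hac.le.trans h1) h2 le_rfl with h | h
      · refine ((edist_triangle_right (x s) (x b) (x a)).trans ?_).trans (e2.le.trans e24)
        exact add_le_add h.le hclose.le
      · rw [edist_comm]
        exact h.le.trans (e12.trans e24)
  -- The switch is the infimum of the times at which `x` has moved away from `x a` by at least `ε`.
  -- From such a time `s₀` on, the modulus leaves only its second alternative, so all later values,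
  -- including `x b`, are near `x s₀`.
  set B : Set I := {s | s ∈ Icc a b ∧ ε ≤ edist (x s) (x a)} with hB
  have hbB : b ∈ B := ⟨⟨hab.le, le_rfl⟩, not_lt.1 hclose⟩
  obtain ⟨c, hc⟩ : ∃ c, IsGLB B c := ⟨sInf B, isGLB_sInf B⟩
  have hcb : c ≤ b := hc.1 hbB
  have hac : a ≤ c := hc.2 fun s hs => hs.1.1
  have hleft : ∀ s, a ≤ s → s < c → edist (x s) (x a) < ε := fun s h1 h2 => by
    by_contra h
    exact h2.not_ge (hc.1 ⟨⟨h1, h2.le.trans hcb⟩, not_lt.1 h⟩)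
  have hright : ∀ s, c < s → s ≤ b → edist (x s) (x b) ≤ 2 * ε := fun s h1 h2 => by
    obtain ⟨s₀, hs₀, hlt⟩ := (isGLB_lt_iff hc).1 h1
    have r1 := (hmod a s₀ s le_rfl hs₀.1.1 hlt.le h2).resolve_left (not_lt.2 hs₀.2)
    have r2 := (hmod a s₀ b le_rfl hs₀.1.1 hs₀.1.2 le_rfl).resolve_left (not_lt.2 hs₀.2)
    exact ((edist_triangle_right _ _ (x s₀)).trans (add_le_add r1.le r2.le)).trans e2.le
  -- Right-continuity adds the point `c` itself.
  have hright' : ∀ s, c ≤ s → s ≤ b → edist (x s) (x b) ≤ 2 * ε := fun s h1 h2 => by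
    rcases h1.lt_or_eq with h | rfl
    · exact hright s h h2
    rcases h2.lt_or_eq with h | rfl
    · have : (𝓝[>] c).NeBot := nhdsGT_neBot_of_exists_gt ⟨b, h⟩
      have ht : Tendsto (fun s => edist (x s) (x b)) (𝓝[>] c) (𝓝 (edist (x c) (x b))) :=
        ((x.rightCts' c).mono Ioi_subset_Ici_self).edist tendsto_const_nhds
      refine le_of_tendsto ht ?_
      filter_upwards [Ioo_mem_nhdsGT h] with s hs
      exact hright s hs.1 hs.2.le
    · simp
  rcases hac.lt_or_eq with hac | rfl
  · exact ⟨c, hac, hcb, fun s h1 h2 => (hleft s h1 h2).le.trans (e12.trans e24),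
      fun s h1 h2 => (hright' s h1 h2).trans e24, fun h => absurd h hclose⟩
  -- If the infimum is `a`, then `x a` is already within `2 * ε` of `x b`, so the path is nearly
  -- constant on the cell and `b` can be the switch.
  · refine ⟨b, hab, le_rfl, fun s h1 h2 => ?_, fun s h1 h2 => ?_, fun h => absurd h hclose⟩
    · refine ((edist_triangle_right _ _ (x b)).trans ?_).trans e4.le
      exact add_le_add (hright' s h1 h2.le) (hright' a le_rfl hab.le)
    · rw [le_antisymm h2 h1]
      simp

/-- Locating a point between nodes that interlace with `τ`. -/
lemma mem_Icc_of_stepCount {m : ℕ} {τ c : ℕ → I} (hτ0 : τ 0 = 0) (hτ1 : ∀ j, m ≤ j → τ j = 1)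
    (hc : StrictMonoOn c (Iio m)) (h : ∀ j < m, τ j ≤ c j ∧ c j ≤ τ (j + 1)) (t : I) :
    t ∈ Icc (τ (stepCount m c t - 1)) (τ (stepCount m c t + 1)) := by
  obtain ⟨h1, h2⟩ := stepCount_spec hc.monotoneOn t
  have hle := stepCount_le m c t
  generalize stepCount m c t = i at h1 h2 hle ⊢
  constructor
  · rcases i with _ | i
    · simp [hτ0]
    · exact (h i (by omega)).1.trans (h1 i (by omega))
  · rcases Nat.lt_or_ge i m with hi | hi
    · exact (h2 i le_rfl hi).le.trans (h i hi).2
    · rw [hτ1 _ (by omega)]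
      exact le_top

/-- Control of a càdlàg function by a step function with deterministic nodes. -/
theorem timeChangeDist_step_le_of_modulusTwo (x : Cadlag S) {δ : ℝ} {ε : ℝ≥0∞} {m : ℕ}
    {τ ρ : ℕ → I} (hm : 0 < m) (hτ : StrictMonoOn τ (Iic m)) (hτ0 : τ 0 = 0)
    (hτ1 : ∀ j, m ≤ j → τ j = 1) (hgap : ∀ j, (τ (j + 1) : ℝ) - τ j ≤ δ)
    (hρ : ∀ j < m, τ j < ρ j ∧ ρ j < τ (j + 1)) (hw : modulusTwo x δ < ε)
    (hx1 : edist (x 1) (x (τ (m - 1))) < ε) :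
    timeChangeDist TimeChange.distId x (step m ρ fun i => x (τ i)) ≤
      max (ENNReal.ofReal (2 * δ)) (4 * ε) := by
  have hlt : ∀ j < m, τ j < τ (j + 1) := fun j hj =>
    hτ (show j ≤ m by omega) (show j + 1 ≤ m by omega) (Nat.lt_succ_self j)
  have hsw : ∀ j, ∃ c, j < m → τ j < c ∧ c ≤ τ (j + 1) ∧
      (∀ s, τ j ≤ s → s < c → edist (x s) (x (τ j)) ≤ 4 * ε) ∧
      (∀ s, c ≤ s → s ≤ τ (j + 1) → edist (x s) (x (τ (j + 1))) ≤ 4 * ε) ∧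
      (edist (x (τ (j + 1))) (x (τ j)) < ε → c < τ (j + 1)) := fun j => by
    by_cases hj : j < m
    · obtain ⟨c, hc⟩ := x.exists_switch_point (hlt j hj) (hgap j) hw
      exact ⟨c, fun _ => hc⟩
    · exact ⟨0, fun h => absurd h hj⟩
  choose c hc using hsw
  have interlace : ∀ d : ℕ → I, (∀ j < m, τ j < d j ∧ d j ≤ τ (j + 1)) →
      StrictMonoOn d (Iio m) := by
    intro d hd i hi j hj hij
    have hi : i < m := hi
    have hj : j < m := hj
    exact ((hd i hi).2.trans (hτ.monotoneOn (show i + 1 ≤ m by omega) (show j ≤ m by omega)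
      (by omega))).trans_lt (hd j hj).1
  have hcm := interlace c fun j hj => ⟨(hc j hj).1, (hc j hj).2.1⟩
  have hρm := interlace ρ fun j hj => ⟨(hρ j hj).1, (hρ j hj).2.le⟩
  -- A time change fixes 1 and could not carry a switch at 1 to an interior point. The closeness of
  -- the last two sampled values keeps the last switch below 1.
  have hc1 : ∀ j < m, c j < 1 := by
    intro j hj
    have hlast : c (m - 1) < 1 := by
      have e : m - 1 + 1 = m := by omega
      have := (hc (m - 1) (by omega)).2.2.2.2
      rw [e, hτ1 m le_rfl] at this
      exact this hx1
    exact (hcm.monotoneOn (show j < m from hj) (show m - 1 < m by omega) (by omega)).trans_lt hlast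
  obtain ⟨l, hl⟩ := TimeChange.exists_map_interior hcm hρm
    (fun j hj => ⟨bot_le.trans_lt (hc j hj).1, hc1 j hj⟩)
    (fun j hj => ⟨bot_le.trans_lt (hρ j hj).1, (hρ j hj).2.trans_le le_top⟩)
  refine iInf_le_of_le l (max_le_max (iSup_le fun t => ENNReal.ofReal_le_ofReal ?_)
    (iSup_le fun t => ?_))
  -- With matched nodes, `t` and `l t` have the same count `i`, so both lie in the two adjacent
  -- cells from `τ (i - 1)` to `τ (i + 1)`; only one cell remains when `i = 0`.
  · have h1 := mem_Icc_of_stepCount hτ0 hτ1 hcm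
      (fun j hj => ⟨(hc j hj).1.le, (hc j hj).2.1⟩) t
    have h2 := mem_Icc_of_stepCount hτ0 hτ1 hρm
      (fun j hj => ⟨(hρ j hj).1.le, (hρ j hj).2.le⟩) (l t)
    rw [stepCount_orderIso m l hl] at h2
    generalize stepCount m c t = i at h1 h2
    have a1 : (τ (i - 1) : ℝ) ≤ t := by exact_mod_cast h1.1
    have a2 : (t : ℝ) ≤ τ (i + 1) := by exact_mod_cast h1.2
    have a3 : (τ (i - 1) : ℝ) ≤ l t := by exact_mod_cast h2.1
    have a4 : (l t : ℝ) ≤ τ (i + 1) := by exact_mod_cast h2.2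
    have a5 : (τ (i + 1) : ℝ) - τ (i - 1) ≤ 2 * δ := by
      rcases i with _ | i
      · have b1 := hgap 0
        have b2 : (τ 0 : ℝ) < τ (0 + 1) := by exact_mod_cast hlt 0 hm
        simp only [zero_add, Nat.zero_sub] at b1 b2 ⊢
        linarith
      · have b1 := hgap i
        have b2 := hgap (i + 1)
        simp only [Nat.add_sub_cancel]
        linarith
    rw [abs_le]
    constructor <;> linarith
  · rw [step_apply, stepCount_orderIso m l hl]
    obtain ⟨h1, h2⟩ := stepCount_spec hcm.monotoneOn t
    have hle := stepCount_le m c t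
    generalize stepCount m c t = i at h1 h2 hle ⊢
    -- The sampled value at `τ i` serves both the end of the cell before `τ i` and the beginning of
    -- the cell after it.
    rcases le_or_gt t (τ i) with h | h
    · rcases i with _ | i
      · rw [hτ0] at h ⊢
        rw [le_antisymm h bot_le]
        simp
      · exact (hc i (by omega)).2.2.2.1 t (h1 i (by omega)) h
    · have him : i < m := by
        by_contra hi
        rw [hτ1 i (by omega)] at h
        exact h.not_ge le_top
      exact (hc i him).2.2.1 t h.le (h2 i le_rfl him)

end Cadlag

/-! ### Measurability and continuity of evaluations. -/

namespace SkorohodDD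

lemma exists_timeChange_of_edist_lt {x y : SkorohodDD} {ε : ℝ≥0∞} (h : edist x y < ε) :
    ∃ l : TimeChange, (∀ t, ENNReal.ofReal |(l t : ℝ) - t| < ε) ∧
      ∀ t, edist (x t) (y (l t)) < ε := by
  obtain ⟨l, hl⟩ := iInf_lt_iff.1 (show timeChangeDist TimeChange.distId x y < ε from h)
  exact ⟨l, fun t => ((le_iSup (fun s : I => ENNReal.ofReal |(l s : ℝ) - s|) t).trans
      (le_max_left _ _)).trans_lt hl,
    fun t => ((le_iSup (fun t : I => edist (x t) (y (l t))) t).trans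
      (le_max_right _ _)).trans_lt hl⟩

/-- A time change closer to the identity than `s` is to the endpoints keeps `l s` inside the
interval. Leaving the time free restores the openness that a single evaluation lacks. -/
lemma isOpen_setOf_exists_mem_Ioo (a b : I) {U : Set SkorohodD} (hU : IsOpen U) :
    IsOpen {x : SkorohodDD | ∃ s ∈ Ioo a b, x s ∈ U} := by
  refine EMetric.isOpen_iff.2 fun x ⟨s, hs, hxs⟩ => ?_
  obtain ⟨r, hr, hball⟩ := EMetric.isOpen_iff.1 hU _ hxs
  have h1 : (0 : ℝ) < s - a := sub_pos.2 (by exact_mod_cast hs.1)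
  have h2 : (0 : ℝ) < b - s := sub_pos.2 (by exact_mod_cast hs.2)
  refine ⟨min r (ENNReal.ofReal (min (s - a) (b - s))),
    lt_min hr (ENNReal.ofReal_pos.2 (lt_min h1 h2)), fun y hy => ?_⟩
  rw [Metric.mem_eball, edist_comm] at hy
  obtain ⟨l, hl, hxy⟩ := exists_timeChange_of_edist_lt hy
  have h3 := (ENNReal.ofReal_lt_ofReal_iff (lt_min h1 h2)).1 ((hl s).trans_le (min_le_right _ _))
  have h4 := abs_lt.1 (h3.trans_le (min_le_left _ _))
  have h5 := abs_lt.1 (h3.trans_le (min_le_right _ _))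
  refine ⟨l s, ⟨?_, ?_⟩, hball ?_⟩
  · rw [← Subtype.coe_lt_coe]; linarith
  · rw [← Subtype.coe_lt_coe]; linarith
  · rw [Metric.mem_eball, edist_comm]
    exact (hxy s).trans_le (min_le_left _ _)

lemma continuous_eval_one : Continuous fun x : SkorohodDD => x 1 := by
  refine continuous_iff_continuousAt.2 fun x => EMetric.tendsto_nhds.2 fun ε hε => ?_
  filter_upwards [Metric.eball_mem_nhds x hε] with y hy
  obtain ⟨l, -, hl⟩ := exists_timeChange_of_edist_lt hy
  have h1 : l 1 = 1 := l.map_top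
  simpa [h1] using hl 1

/-- Evaluation at a point is Borel measurable: for `t < 1` the preimage of a closed set is a
countable intersection of open sets. -/
lemma measurable_eval (t : I) : Measurable fun x : SkorohodDD => x t := by
  rcases eq_or_lt_of_le (show t ≤ 1 from le_top) with rfl | ht
  · exact continuous_eval_one.measurable
  refine measurable_of_isClosed fun F hF => ?_
  obtain ⟨b, -, hb, hlim⟩ := exists_seq_strictAnti_tendsto' ht
  -- By right-continuity, `x t` lies in `F` exactly when there are times arbitrarily close to `t` on
  -- the right with values arbitrarily close to `F`; otherwise the distance to `F` stays bounded
  -- below just after `t`.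
  have hset : (fun x : SkorohodDD => x t) ⁻¹' F = ⋂ m : ℕ, ⋂ n : ℕ,
      {x : SkorohodDD | ∃ s ∈ Ioo t (b n), x s ∈ Metric.thickening (1 / ((m : ℝ) + 1)) F} := by
    ext x
    simp only [mem_preimage, mem_iInter, mem_ofPred_eq]
    constructor
    · intro hx m n
      have h1 : ∀ᶠ s in 𝓝[>] t, x s ∈ Metric.thickening (1 / ((m : ℝ) + 1)) F :=
        ((x.rightCts' t).mono Ioi_subset_Ici_self).eventually
          (Metric.isOpen_thickening.mem_nhds
            (Metric.self_subset_thickening (by positivity) F hx))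
      have : (𝓝[>] t).NeBot := nhdsGT_neBot_of_exists_gt ⟨1, ht⟩
      obtain ⟨s, hs1, hs2⟩ := (h1.and (Ioo_mem_nhdsGT (hb n).1)).exists
      exact ⟨s, hs2, hs1⟩
    · intro h
      by_contra hx
      have hpos : 0 < Metric.infEDist (x t) F := by
        rw [pos_iff_ne_zero, Ne, ← Metric.mem_closure_iff_infEDist_zero, hF.closure_eq]
        exact hx
      obtain ⟨ε, h0, hε⟩ := exists_between hpos
      have h1 : ∀ᶠ s in 𝓝[>] t, ε < Metric.infEDist (x s) F :=
        ((Metric.continuous_infEDist.continuousAt.tendsto.comp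
          ((x.rightCts' t).mono Ioi_subset_Ici_self))).eventually (Ioi_mem_nhds hε)
      obtain ⟨c, hc, hcs⟩ := (mem_nhdsGT_iff_exists_Ioo_subset' ht).1 h1
      obtain ⟨n, hn⟩ := (hlim.eventually (Iio_mem_nhds (show t < c from hc))).exists
      obtain ⟨m, hm⟩ : ∃ m : ℕ, ENNReal.ofReal (1 / ((m : ℝ) + 1)) < ε := by
        have := ENNReal.tendsto_ofReal (tendsto_one_div_add_atTop_nhds_zero_nat (𝕜 := ℝ))
        rw [ENNReal.ofReal_zero] at this
        exact (this.eventually (Iio_mem_nhds h0)).exists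
      obtain ⟨s, hs, hxs⟩ := h m n
      have h2 : ε < Metric.infEDist (x s) F := hcs ⟨hs.1, hs.2.trans hn⟩
      exact absurd (h2.trans (Metric.mem_thickening_iff_infEDist_lt.1 hxs)) (not_lt.2 hm.le)
  rw [hset]
  exact MeasurableSet.iInter fun m => MeasurableSet.iInter fun n =>
    (isOpen_setOf_exists_mem_Ioo t (b n) Metric.isOpen_thickening).measurableSet

lemma measurable_finProj {k : ℕ} (t : Fin k → I) : Measurable (finProj t) :=
  measurable_pi_lambda _ fun i => measurable_eval (t i)

lemma continuousAt_eval {x : SkorohodDD} {t : I} (h : Tendsto x (𝓝[<] t) (𝓝 (x t))) :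
    ContinuousAt (fun y : SkorohodDD => y t) x := by
  have hx : Tendsto x (𝓝 t) (𝓝 (x t)) := by
    rw [← nhdsLT_sup_nhdsGE]
    exact h.sup (x.rightCts' t)
  refine EMetric.tendsto_nhds.2 fun ε hε => ?_
  have hε2 : 0 < ε / 2 := ENNReal.half_pos hε.ne'
  obtain ⟨r, hr, hball⟩ := Metric.mem_nhds_iff.1 (hx.eventually (Metric.eball_mem_nhds _ hε2))
  filter_upwards [Metric.eball_mem_nhds x (lt_min hε2 (ENNReal.ofReal_pos.2 hr))] with y hy
  obtain ⟨l, hl, hxy⟩ := exists_timeChange_of_edist_lt hy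
  have h1 : |(l t : ℝ) - t| < r :=
    (ENNReal.ofReal_lt_ofReal_iff hr).1 ((hl t).trans_le (min_le_right _ _))
  have h2 : edist (x (l t)) (x t) < ε / 2 := hball (show dist (l t) t < r from h1)
  calc edist (y t) (x t) ≤ edist (y t) (x (l t)) + edist (x (l t)) (x t) := edist_triangle _ _ _
    _ < ε / 2 + ε / 2 := ENNReal.add_lt_add ((hxy t).trans_le (min_le_left _ _)) h2
    _ = ε := ENNReal.add_halves ε

/-- The set of times at which `Q`-almost every path is left-continuous. -/
def leftContSet (Q : Measure SkorohodDD) : Set I :=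
  {t | ∀ᵐ x : SkorohodDD ∂Q, Tendsto x (𝓝[<] t) (𝓝 (x t))}

lemma zero_mem_leftContSet (Q : Measure SkorohodDD) : (0 : I) ∈ leftContSet Q := by
  change ∀ᵐ x : SkorohodDD ∂Q, Tendsto x (𝓝[<] 0) (𝓝 (x 0))
  refine Eventually.of_forall fun x => ?_
  have : 𝓝[<] (0 : I) = ⊥ := by
    rw [show Iio (0 : I) = ∅ from Set.Iio_bot, nhdsWithin_empty]
  rw [this]
  exact tendsto_bot

end SkorohodDD

/-! ### Countability of the times of fixed jumps, and grids avoiding them. -/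

/-- Infinitely many events with probabilities bounded below have a common point in infinitely many
of them. -/
lemma exists_frequently_mem_of_le_measure {α : Type*} [MeasurableSpace α] (μ : Measure α)
    [IsFiniteMeasure μ] {A : ℕ → Set α} (hA : ∀ n, MeasurableSet (A n)) {c : ℝ≥0∞} (hc : c ≠ 0)
    (h : ∀ n, c ≤ μ (A n)) : ∃ x, ∃ᶠ n in atTop, x ∈ A n := by
  have hmeas : ∀ N, MeasurableSet (⋃ n, A (N + n)) := fun N =>
    MeasurableSet.iUnion fun n => hA _
  have hanti : Antitone fun N => ⋃ n, A (N + n) := fun N M hNM =>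
    iUnion_subset fun n => by
      have : M + n = N + (M - N + n) := by omega
      rw [this]
      exact subset_iUnion (fun n => A (N + n)) _
  have hlim := tendsto_measure_iInter_atTop (μ := μ) (fun N => (hmeas N).nullMeasurableSet) hanti
    ⟨0, measure_ne_top _ _⟩
  have hle : c ≤ μ (⋂ N, ⋃ n, A (N + n)) := ge_of_tendsto' hlim fun N =>
    (h N).trans (measure_mono (subset_iUnion (fun n => A (N + n)) 0))
  obtain ⟨x, hx⟩ := nonempty_of_measure_ne_zero (ne_bot_of_le_ne_bot hc hle)
  refine ⟨x, frequently_atTop.2 fun N => ?_⟩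
  obtain ⟨n, hn⟩ := mem_iUnion.1 (mem_iInter.1 hx N)
  exact ⟨N + n, Nat.le_add_right _ _, hn⟩

namespace SkorohodDD

/-- All but countably many times lie in `leftContSet Q`. -/
theorem countable_compl_leftContSet (Q : Measure SkorohodDD) [IsFiniteMeasure Q] :
    (leftContSet Q)ᶜ.Countable := by
  have hseq : ∀ t : I, ∃ s : ℕ → I, 0 < t → Tendsto s atTop (𝓝[<] t) := fun t => by
    by_cases ht : 0 < t
    · have : (𝓝[<] t).NeBot := nhdsLT_neBot_of_exists_lt ⟨0, ht⟩
      obtain ⟨s, hs⟩ := exists_seq_tendsto (𝓝[<] t)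
      exact ⟨s, fun _ => hs⟩
    · exact ⟨fun _ => 0, fun h => absurd h ht⟩
  choose s hs using hseq
  let e : ℕ → ℝ≥0∞ := fun k => ((k : ℝ≥0∞) + 1)⁻¹
  have he : ∀ k, e k ≠ 0 := fun k => ENNReal.inv_ne_zero.2 (by finiteness)
  -- Jumps are detected along one fixed sequence increasing to `t` from the left, so that the event
  -- is measurable. Since left limits exist, one sequence is enough.
  let A : I → ℕ → Set SkorohodDD := fun t k =>
    {x | ∃ᶠ n in atTop, e k < edist (x (s t n)) (x t)}
  have hA : ∀ t k, MeasurableSet (A t k) := fun t k => by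
    have : A t k = ⋂ N : ℕ, ⋃ n : ℕ, ⋃ _ : N ≤ n,
        {x : SkorohodDD | e k < edist (x (s t n)) (x t)} := by
      ext x
      simp [A, frequently_atTop]
    rw [this]
    exact MeasurableSet.iInter fun N => MeasurableSet.iUnion fun n => MeasurableSet.iUnion fun _ =>
      measurableSet_lt measurable_const ((measurable_eval _).edist (measurable_eval _))
  -- If infinitely many times had a jump larger than `e k` with probability at least `e j`, one path
  -- would have infinitely many such jumps, against `finite_large_jumps`.
  have hfin : ∀ k j, {t : I | 0 < t ∧ e j ≤ Q (A t k)}.Finite := fun k j => by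
    by_contra hinf
    have hinf : {t : I | 0 < t ∧ e j ≤ Q (A t k)}.Infinite := hinf
    let f := hinf.natEmbedding
    obtain ⟨x, hx⟩ := exists_frequently_mem_of_le_measure Q (A := fun n => A (f n) k)
      (fun n => hA _ _) (he j) (fun n => (f n).2.2)
    refine (Nat.frequently_atTop_iff_infinite.1 hx) ?_
    refine ((x.finite_large_jumps (he k)).preimage
      (f := fun n => (f n : I)) (Subtype.val_injective.comp f.injective).injOn).subset ?_
    intro n hn hev
    refine hn ?_
    filter_upwards [(hs _ (f n).2.1).eventually hev] with i hi
    exact not_lt.2 hi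
  refine (countable_iUnion fun k => countable_iUnion fun j => (hfin k j).countable).mono ?_
  intro t ht
  by_contra hcon
  simp only [mem_iUnion, mem_ofPred_eq, not_exists, not_and, not_le] at hcon
  refine ht ?_
  rcases eq_or_lt_of_le (show 0 ≤ t from bot_le) with rfl | h0
  · exact zero_mem_leftContSet Q
  have hQ : ∀ k, Q (A t k) = 0 := fun k => by
    by_contra hne
    obtain ⟨j, hj⟩ := ENNReal.exists_inv_nat_lt hne
    refine absurd (hcon k j h0) (not_lt.2 (le_trans ?_ hj.le))
    exact ENNReal.inv_le_inv.2 le_self_add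
  have hae : ∀ᵐ x ∂Q, ∀ k, x ∉ A t k := ae_all_iff.2 fun k => measure_eq_zero_iff_ae_notMem.1 (hQ k)
  change ∀ᵐ x : SkorohodDD ∂Q, Tendsto x (𝓝[<] t) (𝓝 (x t))
  filter_upwards [hae] with x hx
  obtain ⟨l, hl⟩ := x.leftLim' t
  have hl' : Tendsto (fun n => edist (x (s t n)) (x t)) atTop (𝓝 (edist l (x t))) :=
    (hl.comp (hs t h0)).edist tendsto_const_nhds
  have hle : ∀ k, edist l (x t) ≤ e k := fun k => by
    have : ∀ᶠ n in atTop, edist (x (s t n)) (x t) ≤ e k := by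
      simpa [A, not_frequently] using hx k
    exact le_of_tendsto hl' this
  have hz : edist l (x t) = 0 := by
    by_contra hne
    obtain ⟨j, hj⟩ := ENNReal.exists_inv_nat_lt hne
    exact absurd ((hle j).trans (ENNReal.inv_le_inv.2 le_self_add)) (not_le.2 hj)
  rwa [← SkorohodD.eq_of_edist_eq_zero hz]

/-- Partitions of `[0, 1]` with small mesh and nodes in a co-countable set. -/
theorem exists_partition_mem {T : Set I} (hT : Tᶜ.Countable) (h0 : (0 : I) ∈ T)
    (h1 : (1 : I) ∈ T) {m : ℕ} (hm : 0 < m) :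
    ∃ τ : ℕ → I, (∀ j, τ j ∈ T) ∧ τ 0 = 0 ∧ (∀ j, m ≤ j → τ j = 1) ∧ StrictMonoOn τ (Iic m) ∧
      ∀ j, (τ (j + 1) : ℝ) - τ j ≤ 2 / m := by
  have hm' : (0 : ℝ) < m := by exact_mod_cast hm
  have hdense : Dense (((↑) : I → ℝ) '' Tᶜ)ᶜ := (hT.image _).dense_compl ℝ
  -- Each node below index `m` is taken in its own cell `[j/m, (j+1)/m)`; this gives strict
  -- monotonicity and a mesh of at most `2/m`.
  have hex : ∀ j, ∃ t : I, t ∈ T ∧ (j = 0 → t = 0) ∧ (m ≤ j → t = 1) ∧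
      (j < m → (j : ℝ) / m ≤ t ∧ (t : ℝ) < (j + 1) / m) := by
    intro j
    rcases Nat.eq_zero_or_pos j with rfl | hj
    · exact ⟨0, h0, fun _ => rfl, fun h => by omega, fun _ => by simp; positivity⟩
    rcases Nat.lt_or_ge j m with hjm | hjm
    · have hlt : (j : ℝ) / m < (j + 1) / m := by gcongr; linarith
      obtain ⟨t, ht, ht'⟩ := hdense.exists_mem_open isOpen_Ioo (nonempty_Ioo.2 hlt)
      have hup : ((j : ℝ) + 1) / m ≤ 1 := by
        rw [div_le_one hm']
        exact_mod_cast hjm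
      have htI : t ∈ I := ⟨le_trans (by positivity) ht'.1.le, ht'.2.le.trans hup⟩
      refine ⟨⟨t, htI⟩, ?_, fun h => by omega, fun h => by omega, fun _ => ⟨ht'.1.le, ht'.2⟩⟩
      by_contra h
      exact ht ⟨⟨t, htI⟩, h, rfl⟩
    · exact ⟨1, h1, fun h => by omega, fun _ => rfl, fun h => by omega⟩
  choose τ hτT hτ0 hτ1 hτ using hex
  refine ⟨τ, hτT, hτ0 0 rfl, hτ1, ?_, fun j => ?_⟩
  · intro i hi j hj hij
    have hj : j ≤ m := hj
    have hi' := hτ i (by omega)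
    rw [← Subtype.coe_lt_coe]
    refine hi'.2.trans_le ?_
    have hij' : (i : ℝ) + 1 ≤ j := by exact_mod_cast hij
    rcases hj.lt_or_eq with hj | rfl
    · refine le_trans ?_ (hτ j hj).1
      gcongr
    · rw [hτ1 j le_rfl, div_le_iff₀ hm']
      simpa using hij'
  · rcases Nat.lt_or_ge (j + 1) m with h | h
    · have a1 := (hτ (j + 1) h).2
      have a2 := (hτ j (by omega)).1
      have : (((j + 1 : ℕ) : ℝ) + 1) / m - j / m = 2 / m := by push_cast; ring
      linarith
    · rw [hτ1 (j + 1) h]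
      rcases Nat.lt_or_ge j m with h' | h'
      · obtain rfl : j + 1 = m := by omega
        have a2 := (hτ j (by omega)).1
        have : (2 : ℝ) / ((j + 1 : ℕ) : ℝ) - (1 - j / ((j + 1 : ℕ) : ℝ)) =
            1 / ((j + 1 : ℕ) : ℝ) := by
          push_cast; field_simp; ring
        have : (0 : ℝ) < 1 / ((j + 1 : ℕ) : ℝ) := by positivity
        simp only [Icc.coe_one]
        linarith
      · rw [hτ1 j h', sub_self]
        positivity

end SkorohodDD

/-! ### Sampling a path on a grid. -/

lemma modulusTwo_mono {S : Type*} [PseudoEMetricSpace S] (x : I → S) {δ δ' : ℝ} (h : δ ≤ δ') :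
    modulusTwo x δ ≤ modulusTwo x δ' :=
  iSup_le fun _ => iSup_le fun _ => iSup_le fun _ => iSup_le fun h' =>
    Cadlag.min_edist_le_modulusTwo x h'.1 h'.2.1 (h'.2.2.trans h)

/-- Sampling times `node 0 = 0 < ⋯ < node m = 1` with small mesh, and switching times between
them. -/
structure SamplingGrid (m : ℕ) where
  node : ℕ → I
  switch : ℕ → I
  node_zero : node 0 = 0
  node_eq_one : ∀ j, m ≤ j → node j = 1
  strictMonoOn_node : StrictMonoOn node (Iic m)
  node_lt_switch : ∀ j < m, node j < switch j ∧ switch j < node (j + 1)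
  mesh_le : ∀ j, (node (j + 1) : ℝ) - node j ≤ 2 / m

namespace SamplingGrid

lemma exists_node_mem {T : Set I} (hT : Tᶜ.Countable) (h0 : (0 : I) ∈ T) (h1 : (1 : I) ∈ T)
    {m : ℕ} (hm : 0 < m) : ∃ G : SamplingGrid m, ∀ j, G.node j ∈ T := by
  obtain ⟨τ, hτT, hτ0, hτ1, hτ, hmesh⟩ := SkorohodDD.exists_partition_mem hT h0 h1 hm
  have hex : ∀ j, ∃ r, j < m → τ j < r ∧ r < τ (j + 1) := fun j => by
    by_cases hj : j < m
    · obtain ⟨r, hr⟩ := exists_between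
        (hτ (show j ≤ m by omega) (show j + 1 ≤ m by omega) (Nat.lt_succ_self j))
      exact ⟨r, fun _ => hr⟩
    · exact ⟨0, fun h => absurd h hj⟩
  choose ρ hρ using hex
  exact ⟨⟨τ, ρ, hτ0, hτ1, hτ, hρ, hmesh⟩, hτT⟩

variable {m : ℕ} (G : SamplingGrid m)

/-- The sampling times as a tuple. -/
def times (i : Fin (m + 1)) : I := G.node i

/-- The path that takes the sampled values, switching at the switching times. -/
def interp (a : Fin (m + 1) → SkorohodD) : SkorohodDD :=
  -- The count never exceeds `m`; the minimum only makes every index legitimate.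
  Cadlag.step m G.switch fun i => a ⟨min i m, by omega⟩

/-- The switching times do not depend on the sampled values, so the identity time change compares
two interpolations. This is the reason for fixing them in advance. -/
lemma lipschitzWith_interp : LipschitzWith 1 G.interp := fun a b => by
  rw [ENNReal.coe_one, one_mul]
  refine Cadlag.timeChangeDist_step_le TimeChange.distId (OrderIso.refl I) (fun _ _ => rfl)
    (by simp [TimeChange.distId_refl]) fun i _ => edist_le_pi_edist a b _

/-- The sampled path. -/
def approx (x : SkorohodDD) : SkorohodDD := G.interp (finProj G.times x)

lemma measurable_approx : Measurable G.approx :=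
  G.lipschitzWith_interp.continuous.measurable.comp (SkorohodDD.measurable_finProj _)

lemma edist_approx_le (hm : 0 < m) (x : SkorohodDD) {ε : ℝ≥0∞} (hw : modulusTwo x (2 / m) < ε)
    (hx : edist (x 1) (x (G.node (m - 1))) < ε) :
    edist x (G.approx x) ≤ max (ENNReal.ofReal (2 * (2 / m))) (4 * ε) := by
  have h : G.approx x = Cadlag.step m G.switch fun i => x (G.node i) := by
    unfold approx interp
    congr 1
    funext i
    change x (G.node (min i m)) = x (G.node i)
    rcases le_total i m with h | h
    · rw [min_eq_left h]
    · rw [min_eq_right h, G.node_eq_one m le_rfl, G.node_eq_one i h]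
  rw [h]
  exact Cadlag.timeChangeDist_step_le_of_modulusTwo x hm G.strictMonoOn_node G.node_zero
    G.node_eq_one G.mesh_le G.node_lt_switch hw hx

lemma tendsto_edist_last (G : ∀ k, SamplingGrid (k + 1)) {x : SkorohodDD}
    (hx : Tendsto x (𝓝[<] 1) (𝓝 (x 1))) :
    Tendsto (fun k => edist (x 1) (x ((G k).node k))) atTop (𝓝 0) := by
  have hmesh : Tendsto (fun k : ℕ => (2 : ℝ) / ((k + 1 : ℕ) : ℝ)) atTop (𝓝 0) := by
    exact (tendsto_const_div_atTop_nhds_zero_nat 2).comp (tendsto_add_atTop_nat 1)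
  have h1 : Tendsto (fun k => (G k).node k) atTop (𝓝 1) := by
    refine tendsto_subtype_rng.2 ?_
    have hlow : ∀ k, (1 : ℝ) - 2 / ((k + 1 : ℕ) : ℝ) ≤ (G k).node k := fun k => by
      have := (G k).mesh_le k
      rw [(G k).node_eq_one (k + 1) le_rfl, Icc.coe_one] at this
      linarith
    refine tendsto_of_tendsto_of_tendsto_of_le_of_le ?_ tendsto_const_nhds hlow
      fun k => ((G k).node k).2.2
    simpa using hmesh.const_sub 1
  have h2 : Tendsto (fun k => (G k).node k) atTop (𝓝[<] 1) := by
    refine tendsto_nhdsWithin_iff.2 ⟨h1, Eventually.of_forall fun k => ?_⟩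
    have := (G k).strictMonoOn_node (show k ≤ k + 1 by omega) (show k + 1 ≤ k + 1 from le_rfl)
      (Nat.lt_succ_self k)
    rwa [(G k).node_eq_one (k + 1) le_rfl] at this
  simpa using (tendsto_const_nhds (x := x 1)).edist (hx.comp h2)

lemma tendsto_approx (G : ∀ k, SamplingGrid (k + 1)) {x : SkorohodDD}
    (hx : Tendsto x (𝓝[<] 1) (𝓝 (x 1))) :
    Tendsto (fun k => (G k).approx x) atTop (𝓝 x) := by
  refine EMetric.tendsto_nhds.2 fun ε hε => ?_
  obtain ⟨ε', h0, hε'⟩ := exists_between hε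
  have h4 : ε' / 4 ≠ 0 := (ENNReal.div_pos h0.ne' (by norm_num)).ne'
  obtain ⟨δ, hδ, hw⟩ := x.exists_modulusTwo_lt h4
  have hmesh : Tendsto (fun k : ℕ => (2 : ℝ) / ((k + 1 : ℕ) : ℝ)) atTop (𝓝 0) :=
    (tendsto_const_div_atTop_nhds_zero_nat 2).comp (tendsto_add_atTop_nat 1)
  have hmesh' : Tendsto (fun k : ℕ => ENNReal.ofReal (2 * ((2 : ℝ) / ((k + 1 : ℕ) : ℝ))))
      atTop (𝓝 0) := by
    simpa using ENNReal.tendsto_ofReal (hmesh.const_mul 2)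
  filter_upwards [hmesh.eventually_lt_const hδ, hmesh'.eventually_lt_const h0,
    (tendsto_edist_last G hx).eventually_lt_const (pos_iff_ne_zero.2 h4)] with k h1 h2 h3
  rw [edist_comm]
  refine lt_of_le_of_lt ?_ hε'
  refine ((G k).edist_approx_le k.succ_pos x ((modulusTwo_mono x h1.le).trans_lt hw) h3).trans ?_
  exact max_le h2.le (ENNReal.mul_div_cancel (by norm_num) (by norm_num)).le

end SamplingGrid

/-! ### Integral estimates and weak convergence. -/

/-- A bound for the integral of a function that is small off a possibly non-measurable set. -/
lemma abs_integral_le_of_compl {Ω : Type*} [MeasurableSpace Ω] (μ : Measure Ω)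
    [IsProbabilityMeasure μ] {F h : Ω → ℝ} {W : Set Ω} {C η : ℝ} (hη : 0 ≤ η)
    (hF : ∀ ω, |F ω| ≤ C) (hh : Integrable h μ) (hh0 : ∀ ω, 0 ≤ h ω)
    (hW : ∀ ω ∉ W, |F ω| ≤ η + C * h ω) :
    |∫ ω, F ω ∂μ| ≤ η + C * (μ W).toReal + C * ∫ ω, h ω ∂μ := by
  obtain ⟨ω₀⟩ := nonempty_of_isProbabilityMeasure μ
  have hC : 0 ≤ C := (abs_nonneg _).trans (hF ω₀)
  -- The measurable hull has the same measure as `W`.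
  set V := toMeasurable μ W
  have hV : MeasurableSet V := measurableSet_toMeasurable μ W
  have hi : Integrable (V.indicator fun _ => C) μ := (integrable_const C).indicator hV
  have hpt : ∀ ω, ‖F ω‖ ≤ η + V.indicator (fun _ => C) ω + C * h ω := fun ω => by
    rw [Real.norm_eq_abs]
    have := mul_nonneg hC (hh0 ω)
    by_cases hω : ω ∈ V
    · rw [indicator_of_mem hω]
      linarith [hF ω]
    · rw [indicator_of_notMem hω]
      linarith [hW ω fun h' => hω (subset_toMeasurable μ W h')]
  have hi' : Integrable (fun ω => η + V.indicator (fun _ => C) ω) μ := (integrable_const η).add hi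
  have hint : Integrable (fun ω => η + V.indicator (fun _ => C) ω + C * h ω) μ :=
    hi'.add (hh.const_mul C)
  refine (norm_integral_le_of_norm_le hint (Eventually.of_forall hpt)).trans (le_of_eq ?_)
  rw [integral_add hi' (hh.const_mul C), integral_add (integrable_const η) hi,
    integral_const_mul, integral_indicator_const _ hV]
  simp [Measure.real, V, measure_toMeasurable, mul_comm]

namespace SamplingGrid

/-- The truncated relative distance between the last two sampled values. -/
def lastGap (k : ℕ) (ε : ℝ≥0∞) (a : Fin (k + 1 + 1) → SkorohodD) : ℝ :=
  (min 1 (edist (a (Fin.last (k + 1))) (a ⟨k, by omega⟩) / ε)).toReal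

lemma lastGap_nonneg (k : ℕ) (ε : ℝ≥0∞) (a : Fin (k + 1 + 1) → SkorohodD) : 0 ≤ lastGap k ε a :=
  ENNReal.toReal_nonneg

lemma lastGap_le_one (k : ℕ) (ε : ℝ≥0∞) (a : Fin (k + 1 + 1) → SkorohodD) : lastGap k ε a ≤ 1 :=
  ENNReal.toReal_le_of_le_ofReal zero_le_one (by simp)

/-- Being bounded, continuous and equal to 1 on gaps of size at least `ε`, `lastGap` dominates the
indicator of a bad last cell and is an admissible test function for the projections. -/
lemma continuous_lastGap (k : ℕ) {ε : ℝ≥0∞} (hε : ε ≠ 0) : Continuous (lastGap k ε) := by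
  have h1 : Continuous fun a : Fin (k + 1 + 1) → SkorohodD =>
      min 1 (edist (a (Fin.last (k + 1))) (a ⟨k, by omega⟩) / ε) :=
    continuous_const.min ((ENNReal.continuous_div_const ε hε).comp
      ((continuous_apply _).edist (continuous_apply _)))
  exact ENNReal.continuousOn_toReal.comp_continuous h1 fun a =>
    ((min_le_left _ _).trans_lt ENNReal.one_lt_top).ne

lemma lastGap_eq_one {k : ℕ} {ε : ℝ≥0∞} (hε : ε ≠ 0) (hε' : ε ≠ ⊤)
    {a : Fin (k + 1 + 1) → SkorohodD}
    (h : ε ≤ edist (a (Fin.last (k + 1))) (a ⟨k, by omega⟩)) : lastGap k ε a = 1 := by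
  have : 1 ≤ edist (a (Fin.last (k + 1))) (a ⟨k, by omega⟩) / ε := by
    rwa [ENNReal.le_div_iff_mul_le (Or.inl hε) (Or.inl hε'), one_mul]
  rw [lastGap, min_eq_left this, ENNReal.toReal_one]

lemma edist_finProj_last {k : ℕ} (G : SamplingGrid (k + 1)) (x : SkorohodDD) :
    edist (finProj G.times x (Fin.last (k + 1))) (finProj G.times x ⟨k, by omega⟩) =
      edist (x 1) (x (G.node k)) := by
  simp only [finProj, times, Fin.val_last]
  rw [G.node_eq_one (k + 1) le_rfl]

lemma tendsto_lastGap (G : ∀ k, SamplingGrid (k + 1)) {ε : ℝ≥0∞} (hε : ε ≠ 0)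
    {x : SkorohodDD} (hx : Tendsto x (𝓝[<] 1) (𝓝 (x 1))) :
    Tendsto (fun k => lastGap k ε (finProj (G k).times x)) atTop (𝓝 0) := by
  have h1 : Tendsto (fun k => min 1 (edist (x 1) (x ((G k).node k)) / ε)) atTop (𝓝 0) := by
    have := (ENNReal.continuous_div_const ε hε).continuousAt.tendsto.comp
      (tendsto_edist_last G hx)
    rw [ENNReal.zero_div] at this
    simpa using (tendsto_const_nhds (x := (1 : ℝ≥0∞))).min this
  have h2 := (ENNReal.tendsto_toReal ENNReal.zero_ne_top).comp h1
  refine (h2.congr fun k => ?_)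
  simp only [Function.comp_apply, lastGap]
  rw [edist_finProj_last]

end SamplingGrid

lemma norm_le_of_dist_le {α : Type*} {f : α → ℝ} {C : ℝ} (hC : ∀ x y, dist (f x) (f y) ≤ C)
    (x₀ x : α) : ‖f x‖ ≤ ‖f x₀‖ + C := by
  have h1 := hC x x₀
  rw [Real.dist_eq] at h1
  have h2 := abs_sub_abs_le_abs_sub (f x) (f x₀)
  simp only [Real.norm_eq_abs]
  linarith

lemma ConvergesWeakly.tendsto_integral_finProj {Ω : Type*} [MeasurableSpace Ω]
    {μ : ℕ → Measure Ω} {X : ℕ → Ω → SkorohodDD} (hX : ∀ n, Measurable (X n))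
    {Q : Measure SkorohodDD} {k : ℕ} {t : Fin k → I}
    (h : ConvergesWeakly (fun n => (μ n).map (fun ω => finProj t (X n ω))) (Q.map (finProj t)))
    {g : (Fin k → SkorohodD) → ℝ} (hg : Continuous g) {C : ℝ} (hC : ∀ a b, dist (g a) (g b) ≤ C) :
    Tendsto (fun n => ∫ ω, g (finProj t (X n ω)) ∂(μ n)) atTop
      (𝓝 (∫ x, g (finProj t x) ∂Q)) := by
  have h1 := h ⟨⟨g, hg⟩, C, hC⟩
  have hgm : ∀ ν : Measure (Fin k → SkorohodD), AEStronglyMeasurable g ν := fun ν =>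
    hg.measurable.aestronglyMeasurable
  have e1 : ∀ n, ∫ a, g a ∂((μ n).map (fun ω => finProj t (X n ω))) =
      ∫ ω, g (finProj t (X n ω)) ∂(μ n) := fun n =>
    integral_map ((SkorohodDD.measurable_finProj t).comp (hX n)).aemeasurable (hgm _)
  have e2 : ∫ a, g a ∂(Q.map (finProj t)) = ∫ x, g (finProj t x) ∂Q :=
    integral_map (SkorohodDD.measurable_finProj t).aemeasurable (hgm _)
  rw [← e2]
  exact h1.congr fun n => e1 n

/-- Weak convergence of random elements of `D([0,1]; D)` from convergence of the projections at
times without fixed jumps and control of the modulus. The paths are compared with step functions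
sampled on a fixed grid, so no compact containment in `D` enters: what is needed of it is already
contained in the convergence of the projections. -/
theorem convergesWeakly_of_finProj_of_modulusTwo {Ω : Type*} [MeasurableSpace Ω]
    (μ : ℕ → Measure Ω) [∀ n, IsProbabilityMeasure (μ n)] (X : ℕ → Ω → SkorohodDD)
    (hX : ∀ n, Measurable (X n)) (Q : Measure SkorohodDD) [IsProbabilityMeasure Q]
    (hfdd : ∀ (k : ℕ) (t : Fin k → I), (∀ i, t i ∈ SkorohodDD.leftContSet Q) →
      ConvergesWeakly (fun n => (μ n).map (fun ω => finProj t (X n ω))) (Q.map (finProj t)))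
    (hone : (1 : I) ∈ SkorohodDD.leftContSet Q)
    (hmod : ∀ ε : ℝ, 0 < ε →
      LimLimsupZero μ (fun n δ => {ω | ENNReal.ofReal ε ≤ modulusTwo (X n ω) δ})) :
    ConvergesWeakly (fun n => (μ n).map (X n)) Q := by
  have hP : ∀ n, IsProbabilityMeasure ((μ n).map (X n)) := fun n =>
    Measure.isProbabilityMeasure_map (hX n).aemeasurable
  refine (convergesWeakly_iff (fun n => ⟨(μ n).map (X n), hP n⟩) ⟨Q, inferInstance⟩).2 ?_
  refine tendsto_iff_forall_lipschitz_integral_tendsto.2 fun f ⟨C, hC⟩ ⟨L, hL⟩ => ?_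
  change Tendsto (fun n => ∫ x, f x ∂((μ n).map (X n))) atTop (𝓝 (∫ x, f x ∂Q))
  simp_rw [fun n => integral_map (hX n).aemeasurable
    (hL.continuous.measurable.aestronglyMeasurable (μ := (μ n).map (X n)))]
  obtain ⟨x₀⟩ := nonempty_of_isProbabilityMeasure Q
  have hC0 : 0 ≤ C := dist_nonneg.trans (hC x₀ x₀)
  have hgrid : ∀ k : ℕ, ∃ G : SamplingGrid (k + 1), ∀ j, G.node j ∈ SkorohodDD.leftContSet Q :=
    fun k => SamplingGrid.exists_node_mem (SkorohodDD.countable_compl_leftContSet Q)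
      (SkorohodDD.zero_mem_leftContSet Q) hone k.succ_pos
  choose G hG using hgrid
  have hone' : ∀ᵐ x : SkorohodDD ∂Q, Tendsto x (𝓝[<] 1) (𝓝 (x 1)) := hone
  have hfbd : ∀ x, ‖f x‖ ≤ ‖f x₀‖ + C := norm_le_of_dist_le hC x₀
  have hQ1 : Tendsto (fun k => ∫ x, f ((G k).approx x) ∂Q) atTop (𝓝 (∫ x, f x ∂Q)) := by
    refine tendsto_integral_of_dominated_convergence (fun _ => ‖f x₀‖ + C)
      (fun k => (hL.continuous.measurable.comp
        (G k).measurable_approx).aestronglyMeasurable) (integrable_const _)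
      (fun k => Eventually.of_forall fun x => hfbd _) ?_
    filter_upwards [hone'] with x hx
    exact hL.continuous.continuousAt.tendsto.comp (SamplingGrid.tendsto_approx G hx)
  -- Three errors of size `η` come from the Lipschitz bound, from sampling under `Q` and from
  -- convergence of the projections; the event of a large modulus and the last gap cost `C * η`
  -- each.
  have key : ∀ η : ℝ, 0 < η →
      ∀ᶠ n in atTop, |∫ ω, f (X n ω) ∂(μ n) - ∫ x, f x ∂Q| ≤ (3 + 2 * C) * η := by
    intro η hη
    -- The denominator `L + 1` also covers `L = 0`; the factor 4 below is the one lost in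
    -- `edist_approx_le`.
    set r : ℝ := η / (L + 1) with hr
    have hr0 : 0 < r := by positivity
    have hLr : L * r ≤ η := by
      rw [hr, mul_div_assoc', div_le_iff₀ (by positivity)]
      nlinarith
    set ε : ℝ := r / 4 with hεdef
    have hε : 0 < ε := by positivity
    have hε0 : ENNReal.ofReal ε ≠ 0 := (ENNReal.ofReal_pos.2 hε).ne'
    have hQ2 : Tendsto (fun k => ∫ x,
        SamplingGrid.lastGap k (ENNReal.ofReal ε) (finProj (G k).times x) ∂Q) atTop (𝓝 0) := by
      rw [← integral_zero SkorohodDD ℝ (μ := Q)]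
      refine tendsto_integral_of_dominated_convergence (fun _ => 1)
        (fun k => ((SamplingGrid.continuous_lastGap k hε0).measurable.comp
          (SkorohodDD.measurable_finProj _)).aestronglyMeasurable) (integrable_const _)
        (fun k => Eventually.of_forall fun x => ?_) ?_
      · rw [Real.norm_of_nonneg (SamplingGrid.lastGap_nonneg _ _ _)]
        exact SamplingGrid.lastGap_le_one _ _ _
      · filter_upwards [hone'] with x hx
        exact SamplingGrid.tendsto_lastGap G hε0 hx
    have hev := (hmod ε hε).eventually_lt_const (ENNReal.ofReal_pos.2 hη)
    have : (𝓝[>] (0 : I)).NeBot := nhdsGT_neBot_of_exists_gt ⟨1, zero_lt_one⟩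
    obtain ⟨δ, hδlim, hδ0⟩ := (hev.and self_mem_nhdsWithin).exists
    have hδ0 : (0 : ℝ) < δ := by exact_mod_cast (show (0 : I) < δ from hδ0)
    have hmesh : Tendsto (fun k : ℕ => (2 : ℝ) / ((k + 1 : ℕ) : ℝ)) atTop (𝓝 0) :=
      (tendsto_const_div_atTop_nhds_zero_nat 2).comp (tendsto_add_atTop_nat 1)
    -- The grid is fixed before `n`: its mesh is below `δ` for the modulus and below `r / 2` for the
    -- displacement in time, and both quantities under `Q` are already small.
    obtain ⟨k, hk1, hk2, hk3, hk4⟩ := ((hmesh.eventually_lt_const hδ0).and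
      ((hmesh.eventually_lt_const (half_pos hr0)).and
      ((Metric.tendsto_nhds.1 hQ1 η hη).and (hQ2.eventually_lt_const hη)))).exists
    have hfd := hfdd (k + 1 + 1) (G k).times fun i => hG k i
    have hn1 := hfd.tendsto_integral_finProj hX
      (hL.continuous.comp (G k).lipschitzWith_interp.continuous) (fun a b => hC _ _)
    have hn2 := hfd.tendsto_integral_finProj hX
      (SamplingGrid.continuous_lastGap k hε0) (C := 1) (fun a b => by
        have a0 := SamplingGrid.lastGap_nonneg k (ENNReal.ofReal ε) a
        have a1 := SamplingGrid.lastGap_le_one k (ENNReal.ofReal ε) a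
        have b0 := SamplingGrid.lastGap_nonneg k (ENNReal.ofReal ε) b
        have b1 := SamplingGrid.lastGap_le_one k (ENNReal.ofReal ε) b
        rw [Real.dist_eq, abs_le]
        constructor <;> linarith)
    filter_upwards [eventually_lt_of_limsup_lt hδlim, hn2.eventually_lt_const hk4,
      Metric.tendsto_nhds.1 hn1 η hη] with n h1 h2 h3
    have hmeasP : Measurable fun ω => finProj (G k).times (X n ω) :=
      (SkorohodDD.measurable_finProj _).comp (hX n)
    have hI1 : Integrable (fun ω => f (X n ω)) (μ n) := Integrable.of_bound
      (hL.continuous.measurable.comp (hX n)).aestronglyMeasurable _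
      (Eventually.of_forall fun ω => hfbd _)
    have hI2 : Integrable (fun ω => f ((G k).approx (X n ω))) (μ n) := Integrable.of_bound
      (hL.continuous.measurable.comp ((G k).measurable_approx.comp (hX n))).aestronglyMeasurable _
      (Eventually.of_forall fun ω => hfbd _)
    have hI3 : Integrable (fun ω => SamplingGrid.lastGap k (ENNReal.ofReal ε)
        (finProj (G k).times (X n ω))) (μ n) := Integrable.of_bound
      ((SamplingGrid.continuous_lastGap k hε0).measurable.comp hmeasP).aestronglyMeasurable 1
      (Eventually.of_forall fun ω => by
        rw [Real.norm_of_nonneg (SamplingGrid.lastGap_nonneg _ _ _)]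
        exact SamplingGrid.lastGap_le_one _ _ _)
    have hmain := abs_integral_le_of_compl (μ n)
      (F := fun ω => f (X n ω) - f ((G k).approx (X n ω))) (C := C) hη.le
      (fun ω => by simpa [Real.dist_eq] using hC (X n ω) ((G k).approx (X n ω))) hI3
      (fun ω => SamplingGrid.lastGap_nonneg _ _ _)
      (W := {ω | ENNReal.ofReal ε ≤ modulusTwo (X n ω) δ}) (fun ω hω => by
        have hw : modulusTwo (X n ω) δ < ENNReal.ofReal ε := not_le.1 hω
        rcases lt_or_ge (edist (X n ω 1) (X n ω ((G k).node k))) (ENNReal.ofReal ε) with hg | hg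
        · have hd := (G k).edist_approx_le k.succ_pos (X n ω)
            ((modulusTwo_mono _ hk1.le).trans_lt hw) hg
          have h4 : 4 * ENNReal.ofReal ε = ENNReal.ofReal r := by
            rw [show (4 : ℝ≥0∞) = ENNReal.ofReal 4 by simp, ← ENNReal.ofReal_mul (by norm_num)]
            congr 1
            rw [hεdef]; ring
          have hd' : edist (X n ω) ((G k).approx (X n ω)) ≤ ENNReal.ofReal r := by
            refine hd.trans (max_le (ENNReal.ofReal_le_ofReal ?_) h4.le)
            linarith
          have hf := (hL (X n ω) ((G k).approx (X n ω))).trans (mul_le_mul_right hd' L)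
          rw [← ENNReal.ofReal_coe_nnreal, ← ENNReal.ofReal_mul (by positivity), edist_dist,
            ENNReal.ofReal_le_ofReal_iff (by positivity), Real.dist_eq] at hf
          have := mul_nonneg hC0 (SamplingGrid.lastGap_nonneg k (ENNReal.ofReal ε)
            (finProj (G k).times (X n ω)))
          linarith
        · rw [SamplingGrid.lastGap_eq_one hε0 ENNReal.ofReal_ne_top
            (hg.trans_eq ((G k).edist_finProj_last _).symm)]
          have := hC (X n ω) ((G k).approx (X n ω))
          rw [Real.dist_eq] at this
          linarith)
    rw [integral_sub hI1 hI2] at hmain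
    have h1' : (μ n {ω | ENNReal.ofReal ε ≤ modulusTwo (X n ω) δ}).toReal ≤ η :=
      ENNReal.toReal_le_of_le_ofReal hη.le h1.le
    have b1 := mul_le_mul_of_nonneg_left h1' hC0
    have b2 := mul_le_mul_of_nonneg_left h2.le hC0
    rw [Real.dist_eq] at h3 hk3
    have h3' : |∫ ω, f ((G k).approx (X n ω)) ∂(μ n) - ∫ x, f ((G k).approx x) ∂Q| < η := h3
    rw [abs_le] at hmain ⊢
    rw [abs_lt] at h3' hk3
    constructor <;> linarith [hmain.1, hmain.2, h3'.1, h3'.2, hk3.1, hk3.2]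
  refine Metric.tendsto_nhds.2 fun e he => ?_
  have hpos : 0 < 3 + 2 * C := by linarith
  filter_upwards [key (e / (2 * (3 + 2 * C))) (by positivity)] with n hn
  rw [Real.dist_eq]
  refine hn.trans_lt ?_
  have : (3 + 2 * C) * (e / (2 * (3 + 2 * C))) = e / 2 := by field_simp
  linarith

/-! ### Left-continuity times against the two sets of times in the theorem. -/

namespace SkorohodDD

/-- The left limit at 1 exists, so one sequence decides whether it equals `x 1`. If it did not, the
distances along the sequence would eventually exceed some `1 / (k + 1)`, which convergence in
probability makes a null event. -/
lemma one_mem_leftContSet {Q : Measure SkorohodDD}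
    (h : ∀ ε : ℝ, 0 < ε →
      Tendsto (fun δ : I => Q {x | ENNReal.ofReal ε ≤ edist (x 1) (x (unitInterval.symm δ))})
        (𝓝[>] (0 : I)) (𝓝 0)) : (1 : I) ∈ leftContSet Q := by
  have : (𝓝[>] (0 : I)).NeBot := nhdsGT_neBot_of_exists_gt ⟨1, zero_lt_one⟩
  obtain ⟨δ, hδ⟩ := exists_seq_tendsto (𝓝[>] (0 : I))
  have hs : Tendsto (fun n => unitInterval.symm (δ n)) atTop (𝓝[<] 1) := by
    obtain ⟨h1, h2⟩ := tendsto_nhdsWithin_iff.1 hδ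
    refine tendsto_nhdsWithin_iff.2 ⟨?_, h2.mono fun n hn => ?_⟩
    · simpa [Function.comp_def] using (unitInterval.continuous_symm.tendsto 0).comp h1
    · have hn : (0 : ℝ) < δ n := by exact_mod_cast (show (0 : I) < δ n from hn)
      change unitInterval.symm (δ n) < 1
      rw [← Subtype.coe_lt_coe, unitInterval.coe_symm_eq, Icc.coe_one]
      linarith
  have hnull : ∀ k : ℕ, Q {x | ∀ᶠ n in atTop,
      ENNReal.ofReal (1 / ((k : ℝ) + 1)) ≤ edist (x 1) (x (unitInterval.symm (δ n)))} = 0 := by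
    intro k
    have hset : {x : SkorohodDD | ∀ᶠ n in atTop,
        ENNReal.ofReal (1 / ((k : ℝ) + 1)) ≤ edist (x 1) (x (unitInterval.symm (δ n)))} =
        ⋃ N : ℕ, {x | ∀ n, N ≤ n →
          ENNReal.ofReal (1 / ((k : ℝ) + 1)) ≤ edist (x 1) (x (unitInterval.symm (δ n)))} := by
      ext x
      simp [eventually_atTop]
    -- Each set of the union lies in the events for all `n ≥ N`, whose measures tend to zero.
    rw [hset, measure_iUnion_null_iff]
    intro N
    refine le_antisymm (ge_of_tendsto ((h _ (Nat.one_div_pos_of_nat (n := k))).comp hδ) ?_) bot_le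
    filter_upwards [eventually_ge_atTop N] with n hn
    exact measure_mono fun x hx => hx n hn
  have hae : ∀ᵐ x : SkorohodDD ∂Q, ∀ k : ℕ, ¬ ∀ᶠ n in atTop,
      ENNReal.ofReal (1 / ((k : ℝ) + 1)) ≤ edist (x 1) (x (unitInterval.symm (δ n))) :=
    ae_all_iff.2 fun k => measure_eq_zero_iff_ae_notMem.1 (hnull k)
  change ∀ᵐ x : SkorohodDD ∂Q, Tendsto x (𝓝[<] 1) (𝓝 (x 1))
  filter_upwards [hae] with x hx
  obtain ⟨l, hl⟩ := x.leftLim' 1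
  have hlim : Tendsto (fun n => edist (x 1) (x (unitInterval.symm (δ n)))) atTop
      (𝓝 (edist (x 1) l)) := tendsto_const_nhds.edist (hl.comp hs)
  have hz : edist (x 1) l = 0 := by
    by_contra hne
    have h0 := ENNReal.tendsto_ofReal (tendsto_one_div_add_atTop_nhds_zero_nat (𝕜 := ℝ))
    rw [ENNReal.ofReal_zero] at h0
    obtain ⟨k, hk⟩ := (h0.eventually_lt_const (pos_iff_ne_zero.2 hne)).exists
    exact hx k ((hlim.eventually_const_lt hk).mono fun n hn => hn.le)
  rwa [SkorohodD.eq_of_edist_eq_zero hz]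

/-- Only this inclusion is needed: convergence of projections is then available at every
left-continuity time. -/
lemma leftContSet_subset_projContSet (Q : Measure SkorohodDD) :
    leftContSet Q ⊆ projContSet Q := fun t ht => by
  have ht : ∀ᵐ x : SkorohodDD ∂Q, Tendsto x (𝓝[<] t) (𝓝 (x t)) := ht
  exact ht.mono fun x hx => continuousAt_eval hx

lemma leftContSet_map_subset_noFixedJumpSet {Ω : Type*} [MeasurableSpace Ω] (ℙ : Measure Ω)
    {Y : Ω → SkorohodDD} (hY : Measurable Y) :
    leftContSet (ℙ.map Y) ⊆ noFixedJumpSet ℙ Y := fun t ht => by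
  have ht : ∀ᵐ x : SkorohodDD ∂(ℙ.map Y), Tendsto x (𝓝[<] t) (𝓝 (x t)) := ht
  refine (ae_of_ae_map hY.aemeasurable ht).mono fun ω hω => ?_
  -- At 0 the left neighbourhood filter is trivial and `leftLim` takes the value of the path.
  rcases eq_or_neBot (𝓝[<] t) with h | h
  · exact (leftLim_eq_of_eq_bot _ h).symm
  · exact (leftLim_eq_of_tendsto hω).symm

end SkorohodDD

end

theorem mainTheorem9 :
    -- version for probability measures
    (∀ (P : ℕ → Measure SkorohodDD) (Q : Measure SkorohodDD)
      [∀ n, IsProbabilityMeasure (P n)] [IsProbabilityMeasure Q],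
      (∀ (k : ℕ) (t : Fin k → I), (∀ i, t i ∈ projContSet Q) →
        ConvergesWeakly (fun n => (P n).map (finProj t)) (Q.map (finProj t))) →
      (∀ ε : ℝ, 0 < ε →
        LimLimsupZero P (fun _ δ => {x | ∃ t : I, ENNReal.ofReal ε ≤ modulusTwo (x t) δ}) ∧
        LimLimsupZero P (fun _ δ => {x | ∃ t : I, ε ≤ |x t δ - x t 0|}) ∧
        LimLimsupZero P (fun _ δ =>
          {x | ∃ t : I, ε ≤ |Function.leftLim (x t) 1 - x t (unitInterval.symm δ)|})) →
      (∀ ε : ℝ, 0 < ε →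
        LimLimsupZero P (fun _ δ => {x | ENNReal.ofReal ε ≤ modulusTwo x δ})) →
      (∀ ε : ℝ, 0 < ε →
        Tendsto (fun δ : I => Q {x | ENNReal.ofReal ε ≤ edist (x 1) (x (unitInterval.symm δ))})
          (𝓝[>] (0 : I)) (𝓝 0)) →
      ConvergesWeakly P Q) ∧
    -- version for random elements
    (∀ (Ω : Type*) [MeasurableSpace Ω] (ℙ : Measure Ω) [IsProbabilityMeasure ℙ]
      (X : ℕ → Ω → SkorohodDD) (Y : Ω → SkorohodDD),
      (∀ n, Measurable (X n)) → Measurable Y →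
      (∀ (k : ℕ) (t : Fin k → I), (∀ i, t i ∈ noFixedJumpSet ℙ Y) →
        ConvergesWeakly (fun n => ℙ.map (fun ω => finProj t (X n ω)))
          (ℙ.map (fun ω => finProj t (Y ω)))) →
      (∀ ε : ℝ, 0 < ε →
        Tendsto (fun δ : I => ℙ {ω | ENNReal.ofReal ε ≤ edist (Y ω 1) (Y ω (unitInterval.symm δ))})
          (𝓝[>] (0 : I)) (𝓝 0)) →
      (∀ ε : ℝ, 0 < ε →
        LimLimsupZero (fun _ => ℙ)
          (fun n δ => {ω | ∃ t : I, ENNReal.ofReal ε ≤ modulusTwo (X n ω t) δ}) ∧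
        LimLimsupZero (fun _ => ℙ) (fun n δ => {ω | ∃ t : I, ε ≤ |X n ω t δ - X n ω t 0|}) ∧
        LimLimsupZero (fun _ => ℙ) (fun n δ =>
          {ω | ∃ t : I, ε ≤ |Function.leftLim (X n ω t) 1 - X n ω t (unitInterval.symm δ)|})) →
      (∀ ε : ℝ, 0 < ε →
        LimLimsupZero (fun _ => ℙ) (fun n δ => {ω | ENNReal.ofReal ε ≤ modulusTwo (X n ω) δ})) →
      ConvergesWeakly (fun n => ℙ.map (X n)) (ℙ.map Y)) := by
  refine ⟨fun P Q _ _ hfdd _ hmod hone => ?_, fun Ω _ ℙ _ X Y hX hY hfdd hone _ hmod => ?_⟩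
  · have h := convergesWeakly_of_finProj_of_modulusTwo P (fun _ => id) (fun _ => measurable_id) Q
      (fun k t ht => hfdd k t fun i => SkorohodDD.leftContSet_subset_projContSet Q (ht i))
      (SkorohodDD.one_mem_leftContSet hone) hmod
    simpa only [Measure.map_id] using h
  · have := Measure.isProbabilityMeasure_map (μ := ℙ) hY.aemeasurable
    refine convergesWeakly_of_finProj_of_modulusTwo (fun _ => ℙ) X hX (ℙ.map Y)
      (fun k t ht => ?_) (SkorohodDD.one_mem_leftContSet fun ε hε => ?_) hmod
    · rw [Measure.map_map (SkorohodDD.measurable_finProj t) hY]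
      exact hfdd k t fun i => SkorohodDD.leftContSet_map_subset_noFixedJumpSet ℙ hY (ht i)
    · refine (hone ε hε).congr fun δ => (Measure.map_apply hY ?_).symm
      exact measurableSet_le measurable_const
        ((SkorohodDD.measurable_eval _).edist (SkorohodDD.measurable_eval _))
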